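/- Let $n\ge 2$, $I=\{0,1,\dots,n\}$, and let $A=(a_{ij})_{i,j\in I}$ be the Cartan matrix of type $C_n^{(1)}$: $a_{ii}=2$, $a_{ij}=0$ if $|i-j|\ge 2$, $a_{1,0}=a_{n-1,n}=-2$, and $a_{ij}=-1$ for all other pairs with $|i-j|=1$. Put $s_0=s_n=2$ and $s_i=1$ for $0<i<n$, so that $(s_ia_{ij})$ is symmetric, and $q_i=q^{s_i}$. Let $P^\vee=\bigoplus_{i\in I}\mathbb Z h_i\oplus\mathbb Z d$, and define $\alpha_j:P^\vee\to\mathbb Z$ by $\alpha_j(h_i)=a_{ij}$ and $\alpha_j(d)=\delta_{0j}$. The quantized universal enveloping algebra $U_q(\mathfrak g)$ of type $C_n^{(1)}$ is the associative unital $\mathbb Q(q)$-algebra generated by $e_i,f_i$ ($i\in I$) and $q^h$ ($h\in P^\vee$), subject to the relations $$q^0=1,\qquad q^hq^{h'}=q^{h+h'},\qquad q^he_iq^{-h}=q^{\alpha_i(h)}e_i,\qquad q^hf_iq^{-h}=q^{-\alpha_i(h)}f_i,$$ $$e_if_j-f_je_i=\delta_{ij}\frac{k_i-k_i^{-1}}{q_i-q_i^{-1}},\qquad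 k_i=q^{s_ih_i},$$ $$\sum_{r=0}^{1-a_{ij}}(-1)^r\begin{bmatrix}1-a_{ij}\\ r\end{bmatrix}_{q_i}x_i^{1-a_{ij}-r}x_jx_i^r=0\qquad(i\ne j;\ x=e\text{ and }x=f),$$ where $\begin{bmatrix}m\\ r\end{bmatrix}_v=\frac{[m]_v!}{[r]_v!\,[m-r]_v!}$, $[m]_v!=[m]_v\cdots[1]_v$ and $[m]_v=\frac{v^m-v^{-m}}{v-v^{-1}}$. Let $k\in I$. A Young diagram of charge $k$ is a sequence $Y=(y_l)_{l\ge 0}$ of integers with $y_l\le y_{l+1}$ for all $l$ and $y_l=k$ for all large $l$. The Fock space $\mathcal F(\Lambda_k)$ is the $\mathbb Q(q)$-vector space with basis the Young diagrams of charge $k$. The boxes of $Y$ are the pairs $(l,l')\in\mathbb N\times\mathbb Z$ with $y_l<l'\le k$ (the box $l<x\le l+1$, $l'-1<y\le l'$ of the plane). A pair $(l,y)\in\mathbb N\times\mathbb Z$, viewed as a box or as a site, has colour $i\in I$ if $l+y\equiv\pm i \pmod{2n}$. The diagram $Y$ has a concave corner at the site $(0,y_0)$ and, whenever $y_l\ne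 y_{l+1}$, a concave corner at $(l+1,y_{l+1})$ and a convex corner at $(l+1,y_l)$. Define linear operators on $\mathcal F(\Lambda_k)$ as follows. * $E_{(l,y)}Y$ is the diagram obtained from $Y$ by replacing $y_{l-1}=y$ by $y+1$ if $Y$ has a convex corner at $(l,y)$, and $E_{(l,y)}Y=0$ otherwise. * $F_{(l,y)}Y$ is the diagram obtained from $Y$ by replacing $y_l=y$ by $y-1$ if $Y$ has a concave corner at $(l,y)$, and $F_{(l,y)}Y=0$ otherwise. * If $(l,y)$ has colour $i$, then $T^{\pm}_{(l,y)}Y$ equals $q_i^{\pm1}Y$ if $Y$ has a concave corner at $(l,y)$, $q_i^{\mp1}Y$ if $Y$ has a convex corner at $(l,y)$, and $Y$ otherwise. Write $(l',y')>(l,y)$ if $l'+y'>l+y$. For $i\in I$, with all sites $p,p'$ below ranging over the sites of colour $i$, put $$E_i=\sum_{p}\Big(\prod_{p'>p}T^+_{p'}\Big)E_p,\qquad F_i=\sum_{p}\Big(\prod_{p'<p}T^-_{p'}\Big)F_p,\qquad T_i^\pm=\prod_{p}T_p^\pm .$$ On each $Y$ only finitely many terms are nonzero and only finitely many factors are not $1$.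 Further let $H_iY=q^{c_i(Y)-v_i(Y)}Y$, where $c_i(Y)$ and $v_i(Y)$ are the numbers of concave and of convex corners of $Y$ of colour $i$, and let $T_dY=q^{-b_0(Y)}Y$, where $b_0(Y)$ is the number of boxes of $Y$ of colour $0$. Theorem. For every $n\ge2$ and $k\in I$, the $\mathbb Q(q)$-vector space $\mathcal F(\Lambda_k)$ carries a $U_q(\mathfrak g)$-module structure, compatible with its $\mathbb Q(q)$-structure, in which $e_i$, $f_i$, $q^{h_i}$ ($i\in I$) and $q^d$ act as $E_i$, $F_i$, $H_i$ and $T_d$, respectively; in it $k_i^{\pm1}=q^{\pm s_ih_i}$ acts as $T_i^{\pm}$. -/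

import Mathlib

noncomputable section

namespace CnFock

/-- The Cartan matrix `(a_ij)` of type `C_n^{(1)}` (for `n ≥ 2`), with rows and columns indexed by
`I = {0, …, n}`: `2` on the diagonal, `-1` next to the diagonal, except that
`a_{1,0} = a_{n-1,n} = -2`. -/
def cartan (n : ℕ) (i j : Fin (n + 1)) : ℤ :=
  if i = j then 2
  else if (i : ℕ) + 1 = j ∨ (j : ℕ) + 1 = i then
    (if (j : ℕ) = 0 ∨ (j : ℕ) = n then -2 else -1)
  else 0

/-- The symmetrizing integers `s_0 = s_n = 2` and `s_i = 1` otherwise. -/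
def symm (n : ℕ) (i : Fin (n + 1)) : ℕ :=
  if (i : ℕ) = 0 ∨ (i : ℕ) = n then 2 else 1

theorem symm_mul_cartan (n : ℕ) (_hn : 2 ≤ n) (i j : Fin (n + 1)) :
    (symm n i : ℤ) * cartan n i j = (symm n j : ℤ) * cartan n j i := by
  have hi := i.isLt
  have hj := j.isLt
  unfold symm cartan
  simp only [Fin.ext_iff]
  split_ifs <;> omega

/-- The base field `ℚ(q)`. -/
abbrev K : Type := RatFunc ℚ

/-- The indeterminate `q`. -/
def q : K := RatFunc.X

/-- `q_i = q^{s_i}`. -/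
def qi (n : ℕ) (i : Fin (n + 1)) : K := q ^ symm n i

/-- The quantum integer `[m]_v = (v^m - v^{-m}) / (v - v^{-1})`. -/
def qInt (v : K) (m : ℕ) : K := (v ^ m - v⁻¹ ^ m) / (v - v⁻¹)

/-- `[m]_v! = [m]_v ⋯ [1]_v`. -/
def qFact (v : K) (m : ℕ) : K := ∏ r ∈ Finset.range m, qInt v (r + 1)

/-- The quantum binomial coefficient (used for `r ≤ m`). -/
def qBinom (v : K) (m r : ℕ) : K := qFact v m / (qFact v r * qFact v (m - r))

/-- The lattice `P^∨ = ⊕ ℤ h_i ⊕ ℤ d`: the pair `(c, m)` stands for `∑ c_i h_i + m d`. -/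
abbrev Coweight (n : ℕ) : Type := (Fin (n + 1) → ℤ) × ℤ

/-- The element `h_i` of `P^∨`. -/
def hElt (n : ℕ) (i : Fin (n + 1)) : Coweight n := (Pi.single i 1, 0)

/-- The element `d` of `P^∨`. -/
def dElt (n : ℕ) : Coweight n := (0, 1)

/-- The simple root `α_j` on `P^∨`: `α_j(h_i) = a_ij` and `α_j(d) = δ_{0j}`. -/
def simpleRoot (n : ℕ) (j : Fin (n + 1)) (h : Coweight n) : ℤ :=
  ∑ i, h.1 i * cartan n i j + (if j = 0 then h.2 else 0)

/-- The generators `e_i`, `f_i` and `q^h` of the quantized enveloping algebra. -/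
inductive Gen (n : ℕ) : Type
  | e (i : Fin (n + 1)) : Gen n
  | f (i : Fin (n + 1)) : Gen n
  | qpow (h : Coweight n) : Gen n

/-- The free algebra on the generators. -/
abbrev Free (n : ℕ) : Type := FreeAlgebra K (Gen n)

/-- The generator `e_i` in the free algebra. -/
def fe (n : ℕ) (i : Fin (n + 1)) : Free n := FreeAlgebra.ι K (Gen.e i)

/-- The generator `f_i` in the free algebra. -/
def ff (n : ℕ) (i : Fin (n + 1)) : Free n := FreeAlgebra.ι K (Gen.f i)

/-- The generator `q^h` in the free algebra. -/
def fq (n : ℕ) (h : Coweight n) : Free n := FreeAlgebra.ι K (Gen.qpow h)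

/-- The left-hand side
`∑_{r=0}^{1-a_ij} (-1)^r [1-a_ij choose r]_{q_i} x_i^{1-a_ij-r} x_j x_i^r`
of a quantum Serre relation. -/
def serre (n : ℕ) (x : Fin (n + 1) → Free n) (i j : Fin (n + 1)) : Free n :=
  ∑ r ∈ Finset.range ((1 - cartan n i j).toNat + 1),
    ((-1 : K) ^ r * qBinom (qi n i) (1 - cartan n i j).toNat r) •
      (x i ^ ((1 - cartan n i j).toNat - r) * x j * x i ^ r)

/-- The defining relations of the quantized enveloping algebra of type `C_n^{(1)}`, where
`k_i = q^{s_i h_i}`. -/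
inductive Rel (n : ℕ) : Free n → Free n → Prop
  | q_zero : Rel n (fq n 0) 1
  | q_add (h h' : Coweight n) : Rel n (fq n h * fq n h') (fq n (h + h'))
  | q_e (h : Coweight n) (i : Fin (n + 1)) :
      Rel n (fq n h * fe n i * fq n (-h)) (q ^ simpleRoot n i h • fe n i)
  | q_f (h : Coweight n) (i : Fin (n + 1)) :
      Rel n (fq n h * ff n i * fq n (-h)) (q ^ (-simpleRoot n i h) • ff n i)
  | e_f_same (i : Fin (n + 1)) :
      Rel n (fe n i * ff n i - ff n i * fe n i)
        ((qi n i - (qi n i)⁻¹)⁻¹ •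
          (fq n (symm n i • hElt n i) - fq n (-(symm n i • hElt n i))))
  | e_f_ne (i j : Fin (n + 1)) (hij : i ≠ j) :
      Rel n (fe n i * ff n j - ff n j * fe n i) 0
  | serre_e (i j : Fin (n + 1)) (hij : i ≠ j) : Rel n (serre n (fe n) i j) 0
  | serre_f (i j : Fin (n + 1)) (hij : i ≠ j) : Rel n (serre n (ff n) i j) 0

/-- The quantized universal enveloping algebra `U_q(𝔤)` over `ℚ(q)`, for `𝔤` of type
`C_n^{(1)}`. -/
abbrev Uq (n : ℕ) : Type := RingQuot (Rel n)

/-- The generator `e_i` of `U_q(𝔤)`. -/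
def e (n : ℕ) (i : Fin (n + 1)) : Uq n := RingQuot.mkAlgHom K (Rel n) (fe n i)

/-- The generator `f_i` of `U_q(𝔤)`. -/
def f (n : ℕ) (i : Fin (n + 1)) : Uq n := RingQuot.mkAlgHom K (Rel n) (ff n i)

/-- The generator `q^h` of `U_q(𝔤)`. -/
def qpow (n : ℕ) (h : Coweight n) : Uq n := RingQuot.mkAlgHom K (Rel n) (fq n h)

/-- A Young diagram of charge `k`: a weakly increasing sequence of integers that is eventually
equal to `k`. -/
@[ext] structure Diagram (k : ℤ) : Type where
  /-- the sequence `(y_l)` -/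
  y : ℕ → ℤ
  mono : ∀ l, y l ≤ y (l + 1)
  eventually : ∃ N, ∀ l, N ≤ l → y l = k

namespace Diagram

variable {k : ℤ}

theorem monotone (Y : Diagram k) : Monotone Y.y := monotone_nat_of_le_succ Y.mono

theorem le_charge (Y : Diagram k) (l : ℕ) : Y.y l ≤ k := by
  obtain ⟨N, hN⟩ := Y.eventually
  exact (Y.monotone (le_max_left l N)).trans_eq (hN (max l N) (le_max_right _ _))

/-- `Y` has a concave corner at the site `p`: either `p = (0, y_0)`, or `p = (l+1, y_{l+1})` with
`y_l ≠ y_{l+1}`. -/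
def IsConcave (Y : Diagram k) (p : ℕ × ℤ) : Prop :=
  p = (0, Y.y 0) ∨ ∃ l, p = (l + 1, Y.y (l + 1)) ∧ Y.y l ≠ Y.y (l + 1)

/-- `Y` has a convex corner at the site `p`: `p = (l+1, y_l)` with `y_l ≠ y_{l+1}`. -/
def IsConvex (Y : Diagram k) (p : ℕ × ℤ) : Prop :=
  ∃ l, p = (l + 1, Y.y l) ∧ Y.y l ≠ Y.y (l + 1)

theorem finite_concave (Y : Diagram k) : {p | Y.IsConcave p}.Finite := by
  obtain ⟨N, hN⟩ := Y.eventually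
  refine ((Set.finite_Iic N).image (fun l => (l, Y.y l))).subset ?_
  rintro p (rfl | ⟨l, rfl, hl⟩)
  · exact ⟨0, by simp, rfl⟩
  · refine ⟨l + 1, ?_, rfl⟩
    by_contra h
    simp only [Set.mem_Iic, not_le] at h
    exact hl (by rw [hN l (by omega), hN (l + 1) (by omega)])

theorem finite_convex (Y : Diagram k) : {p | Y.IsConvex p}.Finite := by
  obtain ⟨N, hN⟩ := Y.eventually
  refine ((Set.finite_Iic N).image (fun l => (l + 1, Y.y l))).subset ?_
  rintro p ⟨l, rfl, hl⟩
  refine ⟨l, ?_, rfl⟩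
  by_contra h
  simp only [Set.mem_Iic, not_le] at h
  exact hl (by rw [hN l (by omega), hN (l + 1) (by omega)])

/-- The diagram `Y` with the box at the convex corner `p = (l+1, y_l)` removed: `y_l` is replaced
by `y_l + 1`. -/
def removeCorner (Y : Diagram k) (p : ℕ × ℤ) (hp : Y.IsConvex p) : Diagram k where
  y := Function.update Y.y (p.1 - 1) (p.2 + 1)
  mono := by
    obtain ⟨l, rfl, hl⟩ := hp
    have hlt : Y.y l < Y.y (l + 1) := lt_of_le_of_ne (Y.mono l) hl
    intro m
    have hm := Y.mono m
    simp only [Function.update_apply, Nat.add_sub_cancel]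
    split_ifs with h1 h2 h2
    · omega
    · subst h1; omega
    · rw [← h2]; omega
    · exact hm
  eventually := by
    obtain ⟨N, hN⟩ := Y.eventually
    refine ⟨max N (p.1 + 1), fun l hl => ?_⟩
    have h1 := (max_le_iff.1 hl).1
    have h2 := (max_le_iff.1 hl).2
    rw [Function.update_apply, if_neg (by omega), hN l h1]

/-- The diagram `Y` with a box added at the concave corner `p = (l, y_l)`: `y_l` is replaced by
`y_l - 1`, so that a convex corner appears at the site `(l+1, y_l - 1)`. -/
def addCorner (Y : Diagram k) (p : ℕ × ℤ) (hp : Y.IsConcave p) : Diagram k where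
  y := Function.update Y.y p.1 (p.2 - 1)
  mono := by
    intro m
    have hm := Y.mono m
    rcases hp with rfl | ⟨l, rfl, hl⟩
    · rw [Function.update_apply, Function.update_apply, if_neg (Nat.succ_ne_zero m)]
      split_ifs with h1
      · have h2 : m = 0 := h1
        subst h2
        have h3 : Y.y 0 - 1 ≤ Y.y (0 + 1) := by omega
        exact h3
      · exact hm
    · have hlt : Y.y l < Y.y (l + 1) := lt_of_le_of_ne (Y.mono l) hl
      simp only [Function.update_apply]
      split_ifs with h1 h2 h2
      · omega
      · subst h1; omega
      · have h3 : m = l := by omega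
        subst h3; omega
      · exact hm
  eventually := by
    obtain ⟨N, hN⟩ := Y.eventually
    refine ⟨max N (p.1 + 1), fun l hl => ?_⟩
    have h1 := (max_le_iff.1 hl).1
    have h2 := (max_le_iff.1 hl).2
    rw [Function.update_apply, if_neg (by omega), hN l h1]

/-- The boxes of `Y`. The pair `(l, l')` stands for the box `l < x ≤ l+1`, `l'-1 < y ≤ l'` of the
plane; column `l` of `Y` is the part of the strip `l < x ≤ l+1` between the heights `y_l`
and `k`. -/
def boxes (Y : Diagram k) : Set (ℕ × ℤ) := {b | Y.y b.1 < b.2 ∧ b.2 ≤ k}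

theorem finite_boxes (Y : Diagram k) : Y.boxes.Finite := by
  obtain ⟨N, hN⟩ := Y.eventually
  refine ((Set.finite_Iio N).prod (Set.finite_Ioc (Y.y 0) k)).subset ?_
  rintro ⟨l, m⟩ ⟨h1, h2⟩
  simp only at h1 h2
  refine ⟨?_, ?_, h2⟩
  · by_contra h
    simp only [Set.mem_Iio, not_lt] at h
    have := hN l h
    omega
  · exact lt_of_le_of_lt (Y.monotone (Nat.zero_le l)) h1

end Diagram

/-- The points `(l, y)` of `ℕ × ℤ` of colour `i`, i.e. with `l + y ≡ ± i mod 2n`. It is used both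
for sites of corners and for boxes `(l, l')`. -/
def coloured (n : ℕ) (i : Fin (n + 1)) : Set (ℕ × ℤ) :=
  {p | (p.1 : ℤ) + p.2 ≡ (i : ℤ) [ZMOD 2 * n] ∨ (p.1 : ℤ) + p.2 ≡ -(i : ℤ) [ZMOD 2 * n]}

/-- The Fock space `F(Λ_k)`: the `ℚ(q)`-vector space with basis the Young diagrams of
charge `k`. -/
abbrev Fock (k : ℤ) : Type := Diagram k →₀ K

/-- The linear operator that multiplies each Young diagram `Y` by the scalar `c Y`. -/
def diagOp {k : ℤ} (c : Diagram k → K) : Fock k →ₗ[K] Fock k :=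
  Finsupp.linearCombination K (fun Y => Finsupp.single Y (c Y))

open scoped Classical in
/-- The operator `E_{(l,y)}` that removes the convex corner at a site. -/
def siteE {k : ℤ} (p : ℕ × ℤ) : Fock k →ₗ[K] Fock k :=
  Finsupp.linearCombination K (fun Y =>
    if h : Y.IsConvex p then Finsupp.single (Y.removeCorner p h) 1 else 0)

open scoped Classical in
/-- The operator `F_{(l,y)}` that adds a box at the concave corner at a site. -/
def siteF {k : ℤ} (p : ℕ × ℤ) : Fock k →ₗ[K] Fock k :=
  Finsupp.linearCombination K (fun Y =>
    if h : Y.IsConcave p then Finsupp.single (Y.addCorner p h) 1 else 0)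

open scoped Classical in
/-- The eigenvalue on `Y` of the operator `T_{(l,y)}^±` at a site `p` of colour `i`, the sign being
`ε = 1` or `ε = -1`: it is `q_i^ε` at a concave corner, `q_i^{-ε}` at a convex corner, and `1`
elsewhere. -/
def siteT (n : ℕ) (i : Fin (n + 1)) (ε : ℤ) {k : ℤ} (p : ℕ × ℤ) (Y : Diagram k) : K :=
  if Y.IsConcave p then qi n i ^ ε else if Y.IsConvex p then qi n i ^ (-ε) else 1

theorem finite_mulSupport_siteT (n : ℕ) (i : Fin (n + 1)) (ε : ℤ) {k : ℤ} (Y : Diagram k) :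
    (Function.mulSupport (fun p => siteT n i ε p Y)).Finite := by
  refine (Y.finite_concave.union Y.finite_convex).subset ?_
  intro p hp
  by_contra h
  have h1 : ¬ Y.IsConcave p := fun hc => h (Or.inl hc)
  have h2 : ¬ Y.IsConvex p := fun hc => h (Or.inr hc)
  exact hp (by simp [siteT, h1, h2])

/-- The product of the commuting diagonal operators `T_p^±` over all sites `p` of a set `S` of sites
of colour `i`. On every `Y` all but finitely many of the factors are `1`. -/
def prodT (n : ℕ) (i : Fin (n + 1)) (ε : ℤ) {k : ℤ} (S : Set (ℕ × ℤ)) : Fock k →ₗ[K] Fock k :=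
  diagOp (fun Y => ∏ᶠ p ∈ S, siteT n i ε p Y)

/-- The operator `E_i = ∑_p (∏_{p' > p} T_{p'}^+) E_p`, over sites `p`, `p'` of colour `i`, where
`(l', y') > (l, y)` means `l' + y' > l + y`. -/
def E (n : ℕ) (i : Fin (n + 1)) {k : ℤ} : Fock k →ₗ[K] Fock k :=
  Finsupp.linearCombination K (fun Y =>
    ∑ᶠ p ∈ coloured n i,
      prodT n i 1 {p' ∈ coloured n i | (p.1 : ℤ) + p.2 < (p'.1 : ℤ) + p'.2}
        (siteE p (Finsupp.single Y 1)))

/-- The operator `F_i = ∑_p (∏_{p' < p} T_{p'}^-) F_p`, over sites `p`, `p'` of colour `i`. -/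
def F (n : ℕ) (i : Fin (n + 1)) {k : ℤ} : Fock k →ₗ[K] Fock k :=
  Finsupp.linearCombination K (fun Y =>
    ∑ᶠ p ∈ coloured n i,
      prodT n i (-1) {p' ∈ coloured n i | (p'.1 : ℤ) + p'.2 < (p.1 : ℤ) + p.2}
        (siteF p (Finsupp.single Y 1)))

theorem siteE_single {k : ℤ} (p : ℕ × ℤ) (Y : Diagram k) (h : Y.IsConvex p) :
    siteE p (Finsupp.single Y 1) = Finsupp.single (Y.removeCorner p h) 1 := by
  simp [siteE, h]

theorem siteE_single_of_not {k : ℤ} (p : ℕ × ℤ) (Y : Diagram k) (h : ¬ Y.IsConvex p) :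
    siteE p (Finsupp.single Y 1) = 0 := by
  simp [siteE, h]

theorem siteF_single {k : ℤ} (p : ℕ × ℤ) (Y : Diagram k) (h : Y.IsConcave p) :
    siteF p (Finsupp.single Y 1) = Finsupp.single (Y.addCorner p h) 1 := by
  simp [siteF, h]

theorem siteF_single_of_not {k : ℤ} (p : ℕ × ℤ) (Y : Diagram k) (h : ¬ Y.IsConcave p) :
    siteF p (Finsupp.single Y 1) = 0 := by
  simp [siteF, h]

/-- The sum that defines `E_i` has finitely many nonzero terms on each `Y`. -/
theorem finite_support_E (n : ℕ) (i : Fin (n + 1)) {k : ℤ} (Y : Diagram k)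
    (S : ℕ × ℤ → Set (ℕ × ℤ)) :
    (Function.support (fun p => prodT n i 1 (S p) (siteE p (Finsupp.single Y 1)))).Finite := by
  refine Y.finite_convex.subset fun p hp => ?_
  by_contra h
  exact hp (by simp [siteE_single_of_not p Y h])

/-- The sum that defines `F_i` has finitely many nonzero terms on each `Y`. -/
theorem finite_support_F (n : ℕ) (i : Fin (n + 1)) {k : ℤ} (Y : Diagram k)
    (S : ℕ × ℤ → Set (ℕ × ℤ)) :
    (Function.support (fun p => prodT n i (-1) (S p) (siteF p (Finsupp.single Y 1)))).Finite := by
  refine Y.finite_concave.subset fun p hp => ?_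
  by_contra h
  exact hp (by simp [siteF_single_of_not p Y h])

/-- The operator `T_i^±` (`ε = ±1`), the product of the `T_p^±` over all sites `p` of
colour `i`. -/
def T (n : ℕ) (i : Fin (n + 1)) (ε : ℤ) {k : ℤ} : Fock k →ₗ[K] Fock k :=
  prodT n i ε (coloured n i)

/-- The operator by which `q^{h_i}` acts: `Y` is multiplied by `q` to the number of concave minus the
number of convex corners of `Y` of colour `i`. -/
def H (n : ℕ) (i : Fin (n + 1)) {k : ℤ} : Fock k →ₗ[K] Fock k :=
  diagOp (fun Y =>
    q ^ (({p ∈ coloured n i | Y.IsConcave p}.ncard : ℤ) -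
      ({p ∈ coloured n i | Y.IsConvex p}.ncard : ℤ)))

/-- The operator `T_d`: `Y` is multiplied by `q` to minus the number of boxes of `Y` of
colour `0`. -/
def Td (n : ℕ) {k : ℤ} : Fock k →ₗ[K] Fock k :=
  diagOp (fun Y => q ^ (-((Y.boxes ∩ coloured n 0).ncard : ℤ)))

end CnFock

end

/-!
The positions `y_l + l` of a Young diagram `Y = (y_l)` form a set of integers `Y.occ` that determines
`Y`. There is at most one corner at the sites `(l, y)` of given content `c = l + y`: a concave
corner of content `c` if `c` is occupied and `c - 1` is not, and a convex corner if `c - 1` is occupied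
and `c` is not. Removing a convex corner moves an occupied position from `c - 1` to `c`, and adding a
box moves it back. Hence the Fock space sits inside the space with basis all sets of integers
(`embed`), where the two moves are products of an operator that fills a position and one that empties
a position. These operators at different positions commute, and their squares vanish; this gives
`removeOp_comm`, `removeOp_sq`, `removeOp_removeOp_removeOp`, `removeOp_addOp_comm` and their
analogues for `addOp`.

Every content has one colour (`col`), so `E_i` and `F_i` are locally finite sums (`HasLSum`) over the
contents `c` of colour `i` of the moves at `c` twisted by a power of `q_i` (`termE`, `termF`). The
Cartan matrix is the second difference operator on `ℤ` folded along `col` (`bump_col`), which yields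
all commutation factors of moves with diagonal operators. Terms of non-adjacent contents of colours `i`
and `j` commute up to the factor `q_i ^ (± a_ij)` (`termE_mul_termE`, `termF_mul_termF`).

Quantum Serre relations (`serre_of_family`): by linearity, `E_j` may be replaced by one term `y`, of
content `d`. Write `E_i = L + N + R`, where `N` collects the terms of the contents `d ± 1` and `L`, `R`
those below and above. All pairs among `L`, `N`, `R`, `y` except `N`, `y` commute up to powers of `q_i`,
and after reordering all words that contain `L` or `R` cancel. There are exactly `-a_ij` contents of
colour `i` adjacent to `d`, so each word with `1 - a_ij` letters from `N` repeats one of them and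
vanishes.

Commutators: distinct terms of `E_i` and `F_j` commute (`termE_termF_comm`), which leaves the diagonal
contributions `[E_i, F_i]`. Their eigenvalues are the differences of a `potential` along `ℤ`, and the
sum telescopes to `(k_i - k_i⁻¹) / (q_i - q_i⁻¹)` (`E_F_sub`). The torus acts through `pairing`, and a
move of content `c` changes the weight by the simple root of colour `col n c` (`pairing_step`).
-/

noncomputable section

namespace CnFock

/-! ### Diagrams as sets of occupied positions -/

namespace Diagram

variable {k : ℤ}

/-- The set `{y_l + l}` of occupied positions (Maya diagram) of a Young diagram. The corners of the
diagram on the antidiagonal `l + y = c` are read off from the occupation of `c` and `c - 1`. -/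
def occ (Y : Diagram k) : Set ℤ := Set.range fun l : ℕ => Y.y l + l

theorem strictMono_add (Y : Diagram k) : StrictMono fun l : ℕ => Y.y l + l := by
  refine strictMono_nat_of_lt_succ fun l => ?_
  have := Y.mono l
  push_cast
  omega

theorem occ_injective : Function.Injective (occ (k := k)) := by
  intro Y Y' h
  have := (Y.strictMono_add.range_inj Y'.strictMono_add).1 h
  ext l
  have := congrFun this l
  simpa using this

theorem IsConcave.mem_occ {Y : Diagram k} {p : ℕ × ℤ} (h : Y.IsConcave p) :
    (p.1 : ℤ) + p.2 ∈ Y.occ ∧ (p.1 : ℤ) + p.2 - 1 ∉ Y.occ := by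
  rcases h with rfl | ⟨l, rfl, hl⟩
  · refine ⟨⟨0, by simp⟩, ?_⟩
    rintro ⟨m, hm⟩
    have := Y.monotone (Nat.zero_le m)
    simp only at hm
    push_cast at hm
    omega
  · refine ⟨⟨l + 1, by simp [add_comm]⟩, ?_⟩
    rintro ⟨m, hm⟩
    have h1 := Y.mono l
    simp only at hm
    push_cast at hm
    rcases Nat.lt_or_ge l m with h2 | h2
    · have := Y.monotone (show l + 1 ≤ m from h2)
      omega
    · have := Y.monotone h2
      omega

theorem IsConvex.mem_occ {Y : Diagram k} {p : ℕ × ℤ} (h : Y.IsConvex p) :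
    (p.1 : ℤ) + p.2 - 1 ∈ Y.occ ∧ (p.1 : ℤ) + p.2 ∉ Y.occ := by
  obtain ⟨l, rfl, hl⟩ := h
  refine ⟨⟨l, by push_cast; ring⟩, ?_⟩
  rintro ⟨m, hm⟩
  have h1 := Y.mono l
  simp only at hm
  push_cast at hm
  rcases Nat.lt_or_ge l m with h2 | h2
  · have := Y.monotone (show l + 1 ≤ m from h2)
    omega
  · have := Y.monotone h2
    omega

theorem exists_isConcave {Y : Diagram k} {c : ℤ} (h : c ∈ Y.occ) (h' : c - 1 ∉ Y.occ) :
    ∃ p : ℕ × ℤ, (p.1 : ℤ) + p.2 = c ∧ Y.IsConcave p := by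
  obtain ⟨l, rfl⟩ := h
  refine ⟨(l, Y.y l), by simp [add_comm], ?_⟩
  rcases l with _ | l
  · exact Or.inl rfl
  · refine Or.inr ⟨l, rfl, fun hl => h' ⟨l, ?_⟩⟩
    simp only [hl]
    push_cast
    ring

theorem exists_isConvex {Y : Diagram k} {c : ℤ} (h : c - 1 ∈ Y.occ) (h' : c ∉ Y.occ) :
    ∃ p : ℕ × ℤ, (p.1 : ℤ) + p.2 = c ∧ Y.IsConvex p := by
  obtain ⟨l, hl⟩ := h
  simp only at hl
  refine ⟨(l + 1, Y.y l), by push_cast; omega, l, rfl, fun hl' => h' ⟨l + 1, ?_⟩⟩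
  simp only [← hl']
  push_cast
  omega

/-- A diagram has at most one corner on each antidiagonal. -/
theorem injOn_content (Y : Diagram k) :
    Set.InjOn (fun p : ℕ × ℤ => (p.1 : ℤ) + p.2) {p | Y.IsConcave p ∨ Y.IsConvex p} := by
  have key : ∀ {a b : ℕ}, Y.y a + a = Y.y b + b → a = b := fun h => Y.strictMono_add.injective h
  have concave : ∀ {p : ℕ × ℤ}, Y.IsConcave p → p.2 = Y.y p.1 := by
    rintro p (rfl | ⟨l, rfl, -⟩) <;> rfl
  rintro p (hp | hp) p' (hp' | hp') h <;> simp only at h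
  · have h1 := concave hp
    have h2 := concave hp'
    have h3 : p.1 = p'.1 := key (by omega)
    exact Prod.ext h3 (by rw [h1, h2, h3])
  · exact absurd (h ▸ hp.mem_occ.1) hp'.mem_occ.2
  · exact absurd (h ▸ hp'.mem_occ.1) hp.mem_occ.2
  · obtain ⟨l, rfl, -⟩ := hp
    obtain ⟨l', rfl, -⟩ := hp'
    simp only at h
    push_cast at h
    obtain rfl : l = l' := key (by omega)
    rfl

theorem occ_update (Y : Diagram k) (l : ℕ) (z : ℤ) :
    (Set.range fun m : ℕ => Function.update Y.y l z m + m) =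
      insert (z + l) (Y.occ \ {Y.y l + l}) := by
  have key : ∀ {a b : ℕ}, Y.y a + a = Y.y b + b → a = b := fun h => Y.strictMono_add.injective h
  ext c
  constructor
  · rintro ⟨m, rfl⟩
    by_cases hm : m = l
    · subst hm
      simp
    · refine Or.inr ⟨⟨m, by simp [hm]⟩, fun h => hm (key ?_)⟩
      simpa [hm] using h
  · rintro (rfl | ⟨⟨m, rfl⟩, h⟩)
    · exact ⟨l, by simp⟩
    · have hm : m ≠ l := by
        rintro rfl
        exact h rfl
      exact ⟨m, by simp [hm]⟩

theorem occ_removeCorner {Y : Diagram k} {p : ℕ × ℤ} (hp : Y.IsConvex p) :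
    (Y.removeCorner p hp).occ =
      insert ((p.1 : ℤ) + p.2) (Y.occ \ {(p.1 : ℤ) + p.2 - 1}) := by
  obtain ⟨l, rfl, hl⟩ := hp
  refine (Y.occ_update l (Y.y l + 1)).trans ?_
  rw [show Y.y l + 1 + (l : ℤ) = ((l + 1 : ℕ) : ℤ) + Y.y l by push_cast; ring,
    show Y.y l + (l : ℤ) = ((l + 1 : ℕ) : ℤ) + Y.y l - 1 by push_cast; ring]

theorem occ_addCorner {Y : Diagram k} {p : ℕ × ℤ} (hp : Y.IsConcave p) :
    (Y.addCorner p hp).occ =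
      insert ((p.1 : ℤ) + p.2 - 1) (Y.occ \ {(p.1 : ℤ) + p.2}) := by
  have h2 : p.2 = Y.y p.1 := by
    rcases hp with rfl | ⟨l, rfl, -⟩ <;> rfl
  refine (Y.occ_update p.1 (p.2 - 1)).trans ?_
  rw [h2, show Y.y p.1 - 1 + (p.1 : ℤ) = p.1 + Y.y p.1 - 1 by ring, add_comm (Y.y p.1)]

/-- `Step c Y Y'` says that `Y'` is obtained from `Y` by removing the convex corner of content `c`,
that is, by moving an occupied position from `c - 1` to `c`. -/
def Step (c : ℤ) (Y Y' : Diagram k) : Prop :=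
  c - 1 ∈ Y.occ ∧ c ∉ Y.occ ∧ Y'.occ = insert c (Y.occ \ {c - 1})

theorem Step.unique_right {c : ℤ} {Y Y₁ Y₂ : Diagram k} (h₁ : Step c Y Y₁) (h₂ : Step c Y Y₂) :
    Y₁ = Y₂ :=
  occ_injective (h₁.2.2.trans h₂.2.2.symm)

theorem Step.occ_left {c : ℤ} {Y Y' : Diagram k} (h : Step c Y Y') :
    Y.occ = insert (c - 1) (Y'.occ \ {c}) := by
  obtain ⟨h1, h2, h3⟩ := h
  rw [h3]
  ext m
  by_cases hm : m = c - 1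
  · subst hm
    simp [h1]
  · by_cases hm' : m = c
    · subst hm'
      simp [h2, hm]
    · simp [hm, hm']

theorem Step.mem_right {c : ℤ} {Y Y' : Diagram k} (h : Step c Y Y') :
    c ∈ Y'.occ ∧ c - 1 ∉ Y'.occ := by
  rw [h.2.2]
  simp

theorem Step.unique_left {c : ℤ} {Y Y₁ Y₂ : Diagram k} (h₁ : Step c Y₁ Y) (h₂ : Step c Y₂ Y) :
    Y₁ = Y₂ :=
  occ_injective (h₁.occ_left.trans h₂.occ_left.symm)

theorem step_removeCorner {Y : Diagram k} {p : ℕ × ℤ} (hp : Y.IsConvex p) :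
    Step ((p.1 : ℤ) + p.2) Y (Y.removeCorner p hp) :=
  ⟨hp.mem_occ.1, hp.mem_occ.2, occ_removeCorner hp⟩

theorem step_addCorner {Y : Diagram k} {p : ℕ × ℤ} (hp : Y.IsConcave p) :
    Step ((p.1 : ℤ) + p.2) (Y.addCorner p hp) Y := by
  obtain ⟨h1, h2⟩ := hp.mem_occ
  have h3 : (p.1 : ℤ) + p.2 ≠ p.1 + p.2 - 1 := by omega
  refine ⟨?_, ?_, ?_⟩
  · simp [occ_addCorner]
  · simp [occ_addCorner, h3]
  · rw [occ_addCorner]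
    ext m
    by_cases hm : m = (p.1 : ℤ) + p.2
    · subst hm
      simp [h1]
    · by_cases hm' : m = (p.1 : ℤ) + p.2 - 1
      · subst hm'
        simp [h2]
      · simp [hm, hm']

theorem exists_step_iff {c : ℤ} {Y : Diagram k} :
    (∃ Y', Step c Y Y') ↔ c - 1 ∈ Y.occ ∧ c ∉ Y.occ := by
  refine ⟨fun ⟨_, h⟩ => ⟨h.1, h.2.1⟩, fun ⟨h, h'⟩ => ?_⟩
  obtain ⟨p, rfl, hp⟩ := exists_isConvex h h'
  exact ⟨_, step_removeCorner hp⟩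

theorem exists_step_iff' {c : ℤ} {Y : Diagram k} :
    (∃ Y', Step c Y' Y) ↔ c ∈ Y.occ ∧ c - 1 ∉ Y.occ := by
  refine ⟨fun ⟨_, h⟩ => h.mem_right, fun ⟨h, h'⟩ => ?_⟩
  obtain ⟨p, rfl, hp⟩ := exists_isConcave h h'
  exact ⟨_, step_addCorner hp⟩

/-- Removing the corner of content `c` removes one box of content `c`. -/
theorem Step.ncard_boxes {c : ℤ} {Y Y' : Diagram k} (h : Step c Y Y') (S : Set (ℕ × ℤ))
    (J : Set ℤ) (hS : ∀ p : ℕ × ℤ, p ∈ S ↔ (p.1 : ℤ) + p.2 ∈ J) [Decidable (c ∈ J)] :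
    ((Y.boxes ∩ S).ncard : ℤ) = (Y'.boxes ∩ S).ncard + if c ∈ J then 1 else 0 := by
  obtain ⟨p, rfl, hp⟩ := exists_isConvex h.1 h.2.1
  obtain rfl := h.unique_right (step_removeCorner hp)
  have hc := Y.le_charge
  have hfin : ((Y.removeCorner p hp).boxes ∩ S).Finite := (finite_boxes _).inter_of_left S
  obtain ⟨l, rfl, hl⟩ := hp
  have hlt : Y.y l < Y.y (l + 1) := lt_of_le_of_ne (Y.mono l) hl
  have hbox : Y.boxes = insert (l, Y.y l + 1)
      (Y.removeCorner (l + 1, Y.y l) ⟨l, rfl, hl⟩).boxes := by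
    ext ⟨m, z⟩
    have hcl := hc (l + 1)
    by_cases hm : m = l
    · subst hm
      simp only [boxes, removeCorner, Set.mem_ofPred_eq, Set.mem_insert_iff, Prod.mk.injEq,
        Nat.add_sub_cancel, Function.update_self, true_and]
      omega
    · simp [boxes, removeCorner, hm]
  have hnot : (l, Y.y l + 1) ∉ (Y.removeCorner (l + 1, Y.y l) ⟨l, rfl, hl⟩).boxes := by
    simp [boxes, removeCorner]
  have hcont : ((l + 1 : ℕ) : ℤ) + Y.y l = (l : ℤ) + (Y.y l + 1) := by
    push_cast
    ring
  split_ifs with hJ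
  · have hmem : (l, Y.y l + 1) ∈ S := (hS _).2 (by simpa only [hcont] using hJ)
    rw [hbox, Set.insert_inter_of_mem hmem, Set.ncard_insert_of_notMem (fun h => hnot h.1) hfin]
    push_cast
    ring
  · have hmem : (l, Y.y l + 1) ∉ S := fun h => hJ (by simpa only [hcont] using (hS _).1 h)
    rw [hbox, Set.insert_inter_of_notMem hmem, add_zero]

end Diagram

/-! ### Colours of contents -/

/-- The colour of a content `c`: the element `i` of `{0, …, n}` with `c ≡ ± i` modulo `2n`,
encoded as the distance from `c` to the nearest multiple of `2n`. -/
def col (n : ℕ) (c : ℤ) : Fin (n + 1) :=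
  ⟨(min (c % (2 * n)) (2 * n - c % (2 * n))).toNat, by omega⟩

theorem mem_coloured_iff {n : ℕ} (hn : 1 ≤ n) {i : Fin (n + 1)} {p : ℕ × ℤ} :
    p ∈ coloured n i ↔ col n ((p.1 : ℤ) + p.2) = i := by
  have hi := i.isLt
  have h0 := Int.emod_nonneg ((p.1 : ℤ) + p.2) (show (2 * n : ℤ) ≠ 0 by omega)
  have h1 := Int.emod_lt_of_pos ((p.1 : ℤ) + p.2) (show (0 : ℤ) < 2 * n by omega)
  have h2 : (i : ℤ) % (2 * n) = i := Int.emod_eq_of_lt (by omega) (by omega)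
  have h3 : (-(i : ℤ)) % (2 * n) = if (i : ℕ) = 0 then 0 else 2 * (n : ℤ) - i := by
    split_ifs with h
    · simp [h]
    · rw [← Int.add_emod_right, neg_add_eq_sub]
      exact Int.emod_eq_of_lt (by omega) (by omega)
  simp only [coloured, Set.mem_ofPred_eq, Int.ModEq, h2, h3, col, Fin.ext_iff]
  split_ifs <;> omega

theorem col_neg (n : ℕ) (hn : 1 ≤ n) (c : ℤ) : col n (-c) = col n c := by
  have h0 := Int.emod_nonneg c (show (2 * n : ℤ) ≠ 0 by omega)
  have h1 := Int.emod_lt_of_pos c (show (0 : ℤ) < 2 * n by omega)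
  have h3 : (-c) % (2 * n) = if c % (2 * n) = 0 then 0 else 2 * n - c % (2 * n) := by
    have h2 : (-c) % (2 * n) = (-(c % (2 * n))) % (2 * n) := (Int.ModEq.neg (Int.mod_modEq ..)).symm
    rw [h2]
    split_ifs with h
    · simp [h]
    · rw [← Int.add_emod_right, neg_add_eq_sub]
      exact Int.emod_eq_of_lt (by omega) (by omega)
  simp only [col, h3, Fin.ext_iff]
  split_ifs <;> omega

/-- The indicator of a set of contents, as an integer. -/
def ind (S : Set ℤ) (c : ℤ) : ℤ := S.indicator 1 c

theorem ind_of_mem {S : Set ℤ} {c : ℤ} (h : c ∈ S) : ind S c = 1 := by simp [ind, h]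

theorem ind_of_notMem {S : Set ℤ} {c : ℤ} (h : c ∉ S) : ind S c = 0 := by simp [ind, h]

/-- The second difference of the indicator of `S`: the amount by which the weight on `S` grows when
a convex corner of content `c` is removed. -/
def bump (S : Set ℤ) (c : ℤ) : ℤ := 2 * ind S c - ind S (c + 1) - ind S (c - 1)

/-- The Cartan matrix is the folding, along `col`, of the second difference on `ℤ`. -/
theorem bump_col {n : ℕ} (hn : 2 ≤ n) (i : Fin (n + 1)) (c : ℤ) :
    bump {r | col n r = i} c = cartan n i (col n c) := by
  have h0 := Int.emod_nonneg c (show (2 * n : ℤ) ≠ 0 by omega)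
  have h1 := Int.emod_lt_of_pos c (show (0 : ℤ) < 2 * n by omega)
  have hi := i.isLt
  have hadd : (c + 1) % (2 * n) = if c % (2 * n) = 2 * n - 1 then 0 else c % (2 * n) + 1 := by
    rw [← Int.emod_add_emod]
    split_ifs with h
    · rw [h, show (2 * n - 1 + 1 : ℤ) = 2 * n by ring, Int.emod_self]
    · exact Int.emod_eq_of_lt (by omega) (by omega)
  have hsub : (c - 1) % (2 * n) = if c % (2 * n) = 0 then 2 * (n : ℤ) - 1 else c % (2 * n) - 1 := by
    rw [← Int.emod_sub_emod]
    split_ifs with h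
    · rw [h, ← Int.add_emod_right, show (0 - 1 + 2 * n : ℤ) = 2 * n - 1 by ring]
      exact Int.emod_eq_of_lt (by omega) (by omega)
    · exact Int.emod_eq_of_lt (by omega) (by omega)
  simp only [bump, ind, Set.indicator_apply, Set.mem_ofPred_eq, Pi.one_apply, cartan, col, hadd,
    hsub, Fin.ext_iff]
  split_ifs <;> omega

theorem col_add_one_ne {n : ℕ} (hn : 2 ≤ n) (c : ℤ) : col n (c + 1) ≠ col n c := by
  intro h
  have h1 := bump_col hn (col n c) c
  have h2 : ind {r | col n r = col n c} (c + 1) = 1 := ind_of_mem h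
  have h3 : ind {r | col n r = col n c} c = 1 := ind_of_mem rfl
  have h4 : 0 ≤ ind {r | col n r = col n c} (c - 1) := Set.indicator_nonneg (by simp) _
  simp only [bump, h2, h3, cartan, if_true] at h1
  omega

theorem col_sub_one_ne {n : ℕ} (hn : 2 ≤ n) (c : ℤ) : col n (c - 1) ≠ col n c := by
  have := col_add_one_ne hn (c - 1)
  rw [sub_add_cancel] at this
  exact this.symm

theorem prod_zpow_eq_zpow_sum {ι F : Type*} [Field F] {v : F} (hv : v ≠ 0) (s : Finset ι)
    (f : ι → ℤ) : ∏ a ∈ s, v ^ f a = v ^ ∑ a ∈ s, f a := by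
  classical
  induction s using Finset.induction_on with
  | empty => simp
  | insert a s ha ih => rw [Finset.prod_insert ha, Finset.sum_insert ha, zpow_add₀ hv, ih]

/-! ### Weights of diagrams -/

namespace Diagram

variable {k : ℤ}

/-- The contribution of the content `r` to the weight of `Y`: `1` for a concave corner, `-1` for a
convex corner, and `0` otherwise. -/
def height (Y : Diagram k) (r : ℤ) : ℤ := ind Y.occ r - ind Y.occ (r - 1)

theorem height_of_isConcave {Y : Diagram k} {p : ℕ × ℤ} (h : Y.IsConcave p) :
    Y.height ((p.1 : ℤ) + p.2) = 1 := by
  rw [height, ind_of_mem h.mem_occ.1, ind_of_notMem h.mem_occ.2, sub_zero]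

theorem height_of_isConvex {Y : Diagram k} {p : ℕ × ℤ} (h : Y.IsConvex p) :
    Y.height ((p.1 : ℤ) + p.2) = -1 := by
  rw [height, ind_of_mem h.mem_occ.1, ind_of_notMem h.mem_occ.2, zero_sub]

theorem exists_corner_of_height_ne {Y : Diagram k} {r : ℤ} (h : Y.height r ≠ 0) :
    ∃ p : ℕ × ℤ, (Y.IsConcave p ∨ Y.IsConvex p) ∧ (p.1 : ℤ) + p.2 = r := by
  by_cases h1 : r ∈ Y.occ <;> by_cases h2 : r - 1 ∈ Y.occ
  · simp [height, ind_of_mem h1, ind_of_mem h2] at h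
  · obtain ⟨p, hp, hp'⟩ := exists_isConcave h1 h2
    exact ⟨p, Or.inl hp', hp⟩
  · obtain ⟨p, hp, hp'⟩ := exists_isConvex h2 h1
    exact ⟨p, Or.inr hp', hp⟩
  · simp [height, ind_of_notMem h1, ind_of_notMem h2] at h

/-- The antidiagonal gives a bijection from the corners of `Y` in `J` to the contents in `J` at which
the height is nonzero. -/
theorem bijOn_corners (Y : Diagram k) (J : Set ℤ) :
    Set.BijOn (fun p : ℕ × ℤ => (p.1 : ℤ) + p.2)
      ({p | (p.1 : ℤ) + p.2 ∈ J} ∩ {p | Y.IsConcave p ∨ Y.IsConvex p})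
      (J ∩ Function.support Y.height) := by
  refine ⟨?_, Y.injOn_content.mono Set.inter_subset_right, ?_⟩
  · rintro p ⟨hp, h | h⟩
    · exact ⟨hp, by simp [height_of_isConcave h]⟩
    · exact ⟨hp, by simp [height_of_isConvex h]⟩
  · rintro r ⟨hr, hr'⟩
    obtain ⟨p, hp, rfl⟩ := exists_corner_of_height_ne hr'
    exact ⟨p, ⟨hr, hp⟩, rfl⟩

theorem finite_support_height (Y : Diagram k) : (Function.support Y.height).Finite := by
  have h := (Y.finite_concave.union Y.finite_convex).image fun p : ℕ × ℤ => (p.1 : ℤ) + p.2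
  refine h.subset fun r hr => ?_
  obtain ⟨p, hp, rfl⟩ := exists_corner_of_height_ne hr
  exact ⟨p, hp, rfl⟩

/-- The weight of `Y` on a set `S` of contents: the number of concave minus the number of convex
corners with content in `S`. -/
def wt (S : Set ℤ) (Y : Diagram k) : ℤ := ∑ᶠ r ∈ S, Y.height r

theorem Step.ind_occ {c : ℤ} {Y Y' : Diagram k} (h : Step c Y Y') (r : ℤ) :
    ind Y'.occ r = ind Y.occ r + (if r = c then 1 else 0) - (if r = c - 1 then 1 else 0) := by
  obtain ⟨h1, h2, h3⟩ := h
  by_cases hr : r = c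
  · subst hr
    simp [ind, h2, h3, show r ≠ r - 1 by omega]
  · by_cases hr' : r = c - 1
    · subst hr'
      simp [ind, h1, h3]
    · have : r ∈ Y'.occ ↔ r ∈ Y.occ := by simp [h3, hr, hr']
      by_cases hY : r ∈ Y.occ <;> simp [ind, this, hY, hr, hr']

theorem wt_eq_sum {Y : Diagram k} {U : Finset ℤ} (hU : Function.support Y.height ⊆ U)
    (S : Set ℤ) : Y.wt S = ∑ r ∈ U, ind S r * Y.height r := by
  have h : ∀ r, (∑ᶠ (_ : r ∈ S), Y.height r) = ind S r * Y.height r := by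
    intro r
    by_cases hr : r ∈ S <;> simp [hr, ind]
  rw [wt]
  simp only [h]
  refine finsum_eq_sum_of_support_subset _ fun r hr => hU ?_
  exact right_ne_zero_of_mul hr

theorem Step.wt_eq {c : ℤ} {Y Y' : Diagram k} (h : Step c Y Y') (S : Set ℤ) :
    Y'.wt S = Y.wt S + bump S c := by
  classical
  let U : Finset ℤ := Y.finite_support_height.toFinset ∪ Y'.finite_support_height.toFinset ∪
    {c, c + 1, c - 1}
  have hU : Function.support Y.height ⊆ U := fun r hr => by
    simp only [U, Finset.coe_union, Set.Finite.coe_toFinset]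
    exact Or.inl (Or.inl hr)
  have hU' : Function.support Y'.height ⊆ U := fun r hr => by
    simp only [U, Finset.coe_union, Set.Finite.coe_toFinset]
    exact Or.inl (Or.inr hr)
  have hc : c ∈ U := by simp [U]
  have hc1 : c + 1 ∈ U := by simp [U]
  have hc2 : c - 1 ∈ U := by simp [U]
  have hh : ∀ r, ind S r * Y'.height r = ind S r * Y.height r +
      ((if r = c then 2 * ind S c else 0) - (if r = c + 1 then ind S (c + 1) else 0) -
        (if r = c - 1 then ind S (c - 1) else 0)) := by
    intro r
    rw [height, height, h.ind_occ, h.ind_occ]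
    by_cases h1 : r = c
    · subst h1
      simp [show r ≠ r - 1 by omega]
      ring
    · by_cases h2 : r = c + 1
      · subst h2
        simp [show c + 1 ≠ c - 1 by omega, show c ≠ c - 1 by omega]
        ring
      · by_cases h3 : r = c - 1
        · subst h3
          simp [show c - 1 - 1 ≠ c by omega, show c - 1 ≠ c + 1 by omega]
          ring
        · simp [h1, h2, h3, show r - 1 ≠ c by omega, show r - 1 ≠ c - 1 by omega]
  rw [wt_eq_sum hU, wt_eq_sum hU', Finset.sum_congr rfl fun r _ => hh r, Finset.sum_add_distrib,
    Finset.sum_sub_distrib, Finset.sum_sub_distrib, Finset.sum_ite_eq', Finset.sum_ite_eq',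
    Finset.sum_ite_eq', if_pos hc, if_pos hc1, if_pos hc2, bump]

theorem wt_eq_ncard (Y : Diagram k) (S : Set ℤ) (P : Set (ℕ × ℤ))
    (hP : ∀ p : ℕ × ℤ, p ∈ P ↔ (p.1 : ℤ) + p.2 ∈ S) :
    Y.wt S = (({p ∈ P | Y.IsConcave p}.ncard : ℤ) - ({p ∈ P | Y.IsConvex p}.ncard : ℤ)) := by
  obtain rfl : P = {p | (p.1 : ℤ) + p.2 ∈ S} := Set.ext hP
  have h1 : Y.wt S = ∑ᶠ p ∈ {p : ℕ × ℤ | (p.1 : ℤ) + p.2 ∈ S} ∩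
      {p | Y.IsConcave p ∨ Y.IsConvex p}, Y.height ((p.1 : ℤ) + p.2) := by
    rw [wt, ← finsum_mem_inter_support]
    exact (finsum_mem_eq_of_bijOn _ (Y.bijOn_corners S) fun _ _ => rfl).symm
  have h2 : {p : ℕ × ℤ | (p.1 : ℤ) + p.2 ∈ S} ∩ {p | Y.IsConcave p ∨ Y.IsConvex p} =
      {p ∈ {p : ℕ × ℤ | (p.1 : ℤ) + p.2 ∈ S} | Y.IsConcave p} ∪
        {p ∈ {p : ℕ × ℤ | (p.1 : ℤ) + p.2 ∈ S} | Y.IsConvex p} := by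
    ext p
    exact and_or_left
  rw [h1, h2, finsum_mem_union]
  · rw [finsum_mem_congr rfl fun p hp => height_of_isConcave hp.2,
      finsum_mem_congr rfl fun p hp => height_of_isConvex hp.2, 
      finsum_mem_eq_finite_toFinset_sum _ (Y.finite_concave.subset fun p hp => hp.2),
      finsum_mem_eq_finite_toFinset_sum _ (Y.finite_convex.subset fun p hp => hp.2),
      Set.ncard_eq_toFinset_card _ (Y.finite_concave.subset fun p hp => hp.2),
      Set.ncard_eq_toFinset_card _ (Y.finite_convex.subset fun p hp => hp.2)]
    simp only [Finset.sum_const, nsmul_eq_mul]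
    ring
  · exact Set.disjoint_left.2 fun p hp hp' => hp'.2.mem_occ.2 hp.2.mem_occ.1
  · exact Y.finite_concave.subset fun p hp => hp.2
  · exact Y.finite_convex.subset fun p hp => hp.2

theorem finprod_siteT (n : ℕ) (i : Fin (n + 1)) (ε : ℤ) (Y : Diagram k) (S : Set ℤ)
    (P : Set (ℕ × ℤ)) (hP : ∀ p : ℕ × ℤ, p ∈ P ↔ (p.1 : ℤ) + p.2 ∈ S) (hq : qi n i ≠ 0) :
    ∏ᶠ p ∈ P, siteT n i ε p Y = qi n i ^ (ε * Y.wt S) := by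
  obtain rfl : P = {p | (p.1 : ℤ) + p.2 ∈ S} := Set.ext hP
  have hT : ∀ p, Y.IsConcave p ∨ Y.IsConvex p →
      siteT n i ε p Y = qi n i ^ (ε * Y.height ((p.1 : ℤ) + p.2)) := by
    rintro p (h | h)
    · simp [siteT, h, height_of_isConcave h]
    · have h' : ¬ Y.IsConcave p := fun h' => h.mem_occ.2 h'.mem_occ.1
      simp [siteT, h, h', height_of_isConvex h]
  have h1 : ∏ᶠ p ∈ {p : ℕ × ℤ | (p.1 : ℤ) + p.2 ∈ S}, siteT n i ε p Y =
      ∏ᶠ r ∈ S ∩ Function.support Y.height, qi n i ^ (ε * Y.height r) := by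
    rw [← finprod_mem_eq_of_bijOn _ (Y.bijOn_corners S) fun p hp => hT p hp.2]
    refine finprod_mem_inter_mulSupport_eq' _ _ _ fun p hp => ?_
    refine ⟨fun h => ⟨h, ?_⟩, fun h => h.1⟩
    by_contra hcor
    rw [Set.mem_ofPred_eq, not_or] at hcor
    exact hp (by simp [siteT, hcor])
  have hfin := Y.finite_support_height.inter_of_right S
  rw [h1, wt, ← finsum_mem_inter_support, finprod_mem_eq_finite_toFinset_prod _ hfin,
    finsum_mem_eq_finite_toFinset_sum _ hfin, Finset.mul_sum]
  exact prod_zpow_eq_zpow_sum hq _ _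

end Diagram

/-! ### Locally finite sums of endomorphisms -/

section HasLSum

variable {R ι κ V : Type*} [CommRing R] [AddCommGroup V] [Module R V]

/-- `S` is the sum of the family `X` of endomorphisms, which is locally finite: on every vector all
but finitely many members of the family vanish. -/
def HasLSum (X : ι → Module.End R V) (S : Module.End R V) : Prop :=
  ∀ v, (Function.support fun c => X c v).Finite ∧ S v = ∑ᶠ c, X c v

namespace HasLSum

variable {X X' : ι → Module.End R V} {S S' : Module.End R V}

theorem unique (h : HasLSum X S) (h' : HasLSum X S') : S = S' :=
  LinearMap.ext fun v => (h v).2.trans (h' v).2.symm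

theorem exists_of_finite (h : ∀ v, (Function.support fun c => X c v).Finite) :
    ∃ S, HasLSum X S :=
  ⟨{ toFun := fun v => ∑ᶠ c, X c v
     map_add' := fun v w => by
      simp only [map_add]
      exact finsum_add_distrib (h v) (h w)
     map_smul' := fun a v => by
      simp only [map_smul, RingHom.id_apply]
      exact (smul_finsum' a (h v)).symm }, fun v => ⟨h v, rfl⟩⟩

theorem mul_right (h : HasLSum X S) (Z : Module.End R V) :
    HasLSum (fun c => X c * Z) (S * Z) :=
  fun v => h (Z v)

theorem mul_left (h : HasLSum X S) (Z : Module.End R V) :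
    HasLSum (fun c => Z * X c) (Z * S) := by
  refine fun v => ⟨(h v).1.subset fun c hc hc' => hc ?_, ?_⟩
  · simp only [Module.End.mul_apply, hc', map_zero]
  · simp only [Module.End.mul_apply, (h v).2]
    exact Z.toAddMonoidHom.map_finsum (h v).1

theorem smul (h : HasLSum X S) (a : R) : HasLSum (fun c => a • X c) (a • S) := by
  refine fun v => ⟨(h v).1.subset fun c hc hc' => hc ?_, ?_⟩
  · simp only [LinearMap.smul_apply, hc', smul_zero]
  · simp only [LinearMap.smul_apply, (h v).2]
    exact smul_finsum' a (h v).1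

theorem add (h : HasLSum X S) (h' : HasLSum X' S') :
    HasLSum (fun c => X c + X' c) (S + S') := by
  refine fun v => ⟨((h v).1.union (h' v).1).subset (Function.support_add _ _), ?_⟩
  simp only [LinearMap.add_apply, (h v).2, (h' v).2]
  exact (finsum_add_distrib (h v).1 (h' v).1).symm

theorem sub (h : HasLSum X S) (h' : HasLSum X' S') :
    HasLSum (fun c => X c - X' c) (S - S') := by
  refine fun v => ⟨((h v).1.union (h' v).1).subset (Function.support_sub _ _), ?_⟩
  simp only [LinearMap.sub_apply, (h v).2, (h' v).2]
  exact (finsum_sub_distrib (h v).1 (h' v).1).symm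

theorem zero : HasLSum (fun _ : ι => (0 : Module.End R V)) 0 := fun v => by simp

theorem sum {s : Finset κ} {X : κ → ι → Module.End R V} {S : κ → Module.End R V}
    (h : ∀ r ∈ s, HasLSum (X r) (S r)) : HasLSum (fun c => ∑ r ∈ s, X r c) (∑ r ∈ s, S r) := by
  classical
  induction s using Finset.induction_on with
  | empty => simpa using zero
  | insert a s ha ih =>
    simp only [Finset.sum_insert ha]
    exact (h a (Finset.mem_insert_self a s)).add (ih fun r hr => h r (Finset.mem_insert_of_mem hr))

theorem single [DecidableEq ι] (a : ι) (Z : Module.End R V) :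
    HasLSum (fun c => if c = a then Z else 0) Z := by
  refine fun v => ⟨(Set.finite_singleton a).subset fun c hc => ?_, ?_⟩
  · by_contra hca
    exact hc (by simp [show c ≠ a from hca])
  · rw [finsum_eq_single _ a fun c hc => by simp [hc]]
    simp

theorem comp_equiv (h : HasLSum X S) (φ : κ ≃ ι) : HasLSum (fun c => X (φ c)) S := fun v =>
  ⟨(h v).1.preimage φ.injective.injOn, (h v).2.trans (finsum_comp_equiv φ).symm⟩

theorem exists_restrict (h : HasLSum X S) (P : ι → Prop) [DecidablePred P] :
    ∃ S', HasLSum (fun c => if P c then X c else 0) S' :=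
  exists_of_finite fun v => (h v).1.subset fun c hc hc' => hc (by
    by_cases hP : P c
    · simpa [hP] using hc'
    · simp [hP])

theorem commute_smul (h : HasLSum X S) {Z : Module.End R V} {a : R}
    (hZ : ∀ c, Z * X c = a • (X c * Z)) : Z * S = a • (S * Z) := by
  refine (h.mul_left Z).unique ?_
  simp only [hZ]
  exact (h.mul_right Z).smul a

theorem commute_smul' (h : HasLSum X S) {Z : Module.End R V} {a : R}
    (hZ : ∀ c, X c * Z = a • (Z * X c)) : S * Z = a • (Z * S) := by
  refine (h.mul_right Z).unique ?_
  simp only [hZ]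
  exact (h.mul_left Z).smul a

theorem commutator (h : HasLSum X S) (Z : Module.End R V) :
    HasLSum (fun c => X c * Z - Z * X c) (S * Z - Z * S) :=
  (h.mul_right Z).sub (h.mul_left Z)

/-- If all but one member of a family commute with `Z`, then the commutator of `Z` with the sum is
the commutator with that member. -/
theorem commutator_eq [DecidableEq ι] (h : HasLSum X S) {Z : Module.End R V} (a : ι)
    (hZ : ∀ c, c ≠ a → Commute Z (X c)) : Z * S - S * Z = Z * X a - X a * Z := by
  refine ((h.mul_left Z).sub (h.mul_right Z)).unique ?_
  convert HasLSum.single a (Z * X a - X a * Z) using 2 with c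
  split_ifs with hc
  · rw [hc]
  · rw [(hZ c hc).eq, sub_self]

theorem of_single {B : Type*} {X : ι → Module.End R (B →₀ R)} {S : Module.End R (B →₀ R)}
    (h : ∀ b, (Function.support fun c => X c (Finsupp.single b 1)).Finite ∧
      S (Finsupp.single b 1) = ∑ᶠ c, X c (Finsupp.single b 1)) : HasLSum X S := by
  have hfin : ∀ v, (Function.support fun c => X c v).Finite := by
    intro v
    induction v using Finsupp.induction_linear with
    | zero => simp
    | add v w hv hw =>
      refine (hv.union hw).subset ?_
      simp only [map_add]
      exact Function.support_add _ _
    | single b a =>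
      refine (h b).1.subset fun c hc hc' => hc ?_
      simp only at hc' ⊢
      rw [← mul_one a, ← smul_eq_mul, ← Finsupp.smul_single, map_smul, hc', smul_zero]
  obtain ⟨S', hS'⟩ := exists_of_finite hfin
  have : S = S' := Finsupp.lhom_ext' fun b => LinearMap.ext_ring
    ((h b).2.trans (hS' (Finsupp.single b 1)).2.symm)
  exact this ▸ hS'

end HasLSum

end HasLSum

/-! ### Quantum binomial coefficients -/

theorem q_ne_zero : q ≠ 0 := RatFunc.X_ne_zero

theorem q_pow_ne_one {m : ℕ} (hm : m ≠ 0) : q ^ m ≠ 1 := by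
  intro h
  rw [q, ← RatFunc.algebraMap_X, ← map_pow, ← map_one (algebraMap (Polynomial ℚ) (RatFunc ℚ))] at h
  have h' := congrArg Polynomial.natDegree (RatFunc.algebraMap_injective ℚ h)
  rw [Polynomial.natDegree_X_pow, Polynomial.natDegree_one] at h'
  exact hm h'

theorem symm_pos (n : ℕ) (i : Fin (n + 1)) : 0 < symm n i := by
  unfold symm
  split_ifs <;> norm_num

theorem qi_ne_zero (n : ℕ) (i : Fin (n + 1)) : qi n i ≠ 0 := pow_ne_zero _ q_ne_zero

theorem qi_pow_ne_one (n : ℕ) (i : Fin (n + 1)) {m : ℕ} (hm : m ≠ 0) : qi n i ^ m ≠ 1 := by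
  rw [qi, ← pow_mul]
  exact q_pow_ne_one (mul_ne_zero (symm_pos n i).ne' hm)

theorem qi_zpow (n : ℕ) (i : Fin (n + 1)) (m : ℤ) : qi n i ^ m = q ^ ((symm n i : ℤ) * m) := by
  rw [qi, zpow_mul, zpow_natCast]

theorem qi_zpow_cartan {n : ℕ} (hn : 2 ≤ n) (i j : Fin (n + 1)) :
    qi n i ^ cartan n i j = qi n j ^ cartan n j i := by
  rw [qi_zpow, qi_zpow, symm_mul_cartan n hn]

section qBinom

variable {v : K}

theorem sub_inv_ne_zero (h0 : v ≠ 0) (h2 : v ^ 2 ≠ 1) : v - v⁻¹ ≠ 0 := fun h => h2 (by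
  field_simp at h
  linear_combination h)

theorem qi_sub_inv_ne_zero (n : ℕ) (i : Fin (n + 1)) : qi n i - (qi n i)⁻¹ ≠ 0 :=
  sub_inv_ne_zero (qi_ne_zero n i) (qi_pow_ne_one n i two_ne_zero)

theorem qInt_ne_zero (h0 : v ≠ 0) (h : ∀ m : ℕ, m ≠ 0 → v ^ m ≠ 1) {m : ℕ} (hm : m ≠ 0) :
    qInt v m ≠ 0 := by
  have h1 := sub_inv_ne_zero h0 (h 2 two_ne_zero)
  have h2 := sub_inv_ne_zero (pow_ne_zero m h0) (v := v ^ m)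
    (by rw [← pow_mul]; exact h _ (mul_ne_zero hm two_ne_zero))
  rw [qInt, inv_pow]
  exact div_ne_zero h2 h1

theorem qFact_ne_zero (h0 : v ≠ 0) (h : ∀ m : ℕ, m ≠ 0 → v ^ m ≠ 1) (m : ℕ) : qFact v m ≠ 0 :=
  Finset.prod_ne_zero_iff.2 fun r _ => qInt_ne_zero h0 h r.succ_ne_zero

theorem qBinom_zero (h0 : v ≠ 0) (h : ∀ m : ℕ, m ≠ 0 → v ^ m ≠ 1) (m : ℕ) : qBinom v m 0 = 1 := by
  simp [qBinom, show qFact v 0 = 1 from rfl, qFact_ne_zero h0 h]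

theorem qBinom_self (h0 : v ≠ 0) (h : ∀ m : ℕ, m ≠ 0 → v ^ m ≠ 1) (m : ℕ) : qBinom v m m = 1 := by
  simp [qBinom, show qFact v 0 = 1 from rfl, qFact_ne_zero h0 h]

theorem qFact_succ (m : ℕ) : qFact v (m + 1) = qFact v m * qInt v (m + 1) :=
  Finset.prod_range_succ _ _

theorem qInt_one (h0 : v ≠ 0) (h2 : v ^ 2 ≠ 1) : qInt v 1 = 1 := by
  simp [qInt, sub_inv_ne_zero h0 h2]

theorem qInt_two (h0 : v ≠ 0) (h2 : v ^ 2 ≠ 1) : qInt v 2 = v + v⁻¹ := by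
  rw [qInt, div_eq_iff (sub_inv_ne_zero h0 h2)]
  ring

theorem qInt_three (h0 : v ≠ 0) (h2 : v ^ 2 ≠ 1) : qInt v 3 = v ^ 2 + 1 + v⁻¹ ^ 2 := by
  rw [qInt, div_eq_iff (sub_inv_ne_zero h0 h2)]
  field_simp
  ring

theorem qBinom_succ_one (h0 : v ≠ 0) (h : ∀ m : ℕ, m ≠ 0 → v ^ m ≠ 1) (m : ℕ) :
    qBinom v (m + 1) 1 = qInt v (m + 1) := by
  have h1 : qFact v 1 = 1 := by simp [qFact, qInt_one h0 (h 2 two_ne_zero)]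
  rw [qBinom, h1, one_mul, qFact_succ, Nat.add_sub_cancel, mul_div_cancel_left₀]
  exact qFact_ne_zero h0 h m

theorem qBinom_three_two (h0 : v ≠ 0) (h : ∀ m : ℕ, m ≠ 0 → v ^ m ≠ 1) :
    qBinom v 3 2 = qInt v 3 := by
  rw [← qBinom_succ_one h0 h 2, qBinom, qBinom, mul_comm]

end qBinom

/-! ### Quantum Serre relations from `q`-commutation -/

section Serre

variable {A : Type*} [Ring A] [Algebra K A]

/-- The left-hand side of the quantum Serre relation of degree `m` in `x` for elements `x`, `y` of
an algebra. -/
def serreSum (v : K) (m : ℕ) (x y : A) : A :=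
  ∑ r ∈ Finset.range (m + 1), ((-1 : K) ^ r * qBinom v m r) • (x ^ (m - r) * y * x ^ r)

variable {v : K}

theorem serreSum_one (h0 : v ≠ 0) (h : ∀ m : ℕ, m ≠ 0 → v ^ m ≠ 1) (x y : A) :
    serreSum v 1 x y = x * y - y * x := by
  simp [serreSum, Finset.sum_range_succ, qBinom_zero h0 h, qBinom_self h0 h, sub_eq_add_neg]

theorem serreSum_two (h0 : v ≠ 0) (h : ∀ m : ℕ, m ≠ 0 → v ^ m ≠ 1) (x y : A) :
    serreSum v 2 x y = x * x * y - (v + v⁻¹) • (x * y * x) + y * x * x := by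
  simp [serreSum, Finset.sum_range_succ, qBinom_zero h0 h, qBinom_self h0 h,
    qBinom_succ_one h0 h 1, qInt_two h0 (h 2 two_ne_zero), sub_eq_add_neg, pow_two, mul_assoc]
  rw [← neg_smul]
  congr 1
  ring

theorem serreSum_three (h0 : v ≠ 0) (h : ∀ m : ℕ, m ≠ 0 → v ^ m ≠ 1) (x y : A) :
    serreSum v 3 x y = x * x * x * y - (v ^ 2 + 1 + v⁻¹ ^ 2) • (x * x * y * x) +
      (v ^ 2 + 1 + v⁻¹ ^ 2) • (x * y * x * x) - y * x * x * x := by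
  simp [serreSum, Finset.sum_range_succ, qBinom_zero h0 h, qBinom_self h0 h,
    qBinom_succ_one h0 h 2, qBinom_three_two h0 h, qInt_three h0 (h 2 two_ne_zero),
    sub_eq_add_neg, pow_succ, mul_assoc]
  rw [← neg_smul]
  congr 1
  ring

end Serre

section SerreVanishing

variable {F A : Type*} [Field F] [Ring A] [Algebra F A] {v : F} {L N R y : A}

theorem mul_mul_of_mul_eq_smul {a b : A} {t : F} (h : a * b = t • (b * a)) (z : A) :
    a * (b * z) = t • (b * (a * z)) := by
  rw [← mul_assoc, h, smul_mul_assoc, mul_assoc]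

/-- The quantum Serre relation of degree two between `L + N + R` and `y`, when `L`, `N`, `R`
`q`-commute with one another, `L` and `R` `q`-commute with `y`, and the words in `N` and `y` that occur
in it vanish. Moving `L` to the left and `R` to the right in every word, the coefficients cancel. -/
theorem quantum_serre_two (h0 : v ≠ 0)
    (hNL : N * L = v⁻¹ ^ 2 • (L * N)) (hRL : R * L = v⁻¹ ^ 2 • (L * R))
    (hRN : R * N = v⁻¹ ^ 2 • (N * R)) (hyL : y * L = v • (L * y)) (hRy : R * y = v • (y * R))
    (hNN : N * N = 0) (hNyN : N * (y * N) = 0) :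
    (L + N + R) * (L + N + R) * y - (v + v⁻¹) • ((L + N + R) * y * (L + N + R)) +
      y * (L + N + R) * (L + N + R) = 0 := by
  simp only [mul_add, add_mul, mul_assoc, hNL, hRL, hRN, hyL, hRy, hNN, hNyN,
    mul_mul_of_mul_eq_smul hNL, mul_mul_of_mul_eq_smul hyL, mul_mul_of_mul_eq_smul hRy,
    smul_mul_assoc, mul_smul_comm, smul_smul, mul_zero, zero_mul]
  match_scalars <;> field_simp <;> ring

/-- The quantum Serre relation of degree three between `L + N + R` and `y`, under the analogous
assumptions. -/
theorem quantum_serre_three (h0 : v ≠ 0)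
    (hNL : N * L = v⁻¹ ^ 2 • (L * N)) (hRL : R * L = v⁻¹ ^ 2 • (L * R))
    (hRN : R * N = v⁻¹ ^ 2 • (N * R)) (hyL : y * L = v ^ 2 • (L * y))
    (hRy : R * y = v ^ 2 • (y * R)) (hNNN : N * (N * N) = 0) (hNNyN : N * (N * (y * N)) = 0)
    (hNyNN : N * (y * (N * N)) = 0) :
    (L + N + R) * (L + N + R) * (L + N + R) * y -
      (v ^ 2 + 1 + v⁻¹ ^ 2) • ((L + N + R) * (L + N + R) * y * (L + N + R)) +
      (v ^ 2 + 1 + v⁻¹ ^ 2) • ((L + N + R) * y * (L + N + R) * (L + N + R)) -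
      y * (L + N + R) * (L + N + R) * (L + N + R) = 0 := by
  simp only [mul_add, add_mul, mul_assoc, hNL, hRL, hRN, hyL, hRy, hNNN, hNNyN, hNyNN,
    mul_mul_of_mul_eq_smul hNL, mul_mul_of_mul_eq_smul hRL, mul_mul_of_mul_eq_smul hRN,
    mul_mul_of_mul_eq_smul hyL, mul_mul_of_mul_eq_smul hRy,
    smul_mul_assoc, mul_smul_comm, smul_smul, mul_zero, zero_mul]
  match_scalars <;> field_simp <;> ring

/-- If `x` and `z` `q`-commute, then a word with three letters `x + z` repeats `x` or `z`, so that it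
vanishes once `x² = z² = xyx = zyz = 0`. -/
theorem words_eq_zero {x z : A} {t : F} (ht : t ≠ 0) (hzx : z * x = t • (x * z))
    (hx : x * x = 0) (hz : z * z = 0) (hxyx : x * (y * x) = 0) (hzyz : z * (y * z) = 0) :
    (x + z) * ((x + z) * (x + z)) = 0 ∧ (x + z) * ((x + z) * (y * (x + z))) = 0 ∧
      (x + z) * (y * ((x + z) * (x + z))) = 0 := by
  have hxz : x * z = t⁻¹ • (z * x) := by rw [hzx, smul_smul, inv_mul_cancel₀ ht, one_smul]
  have hN : (x + z) * (x + z) = (1 + t) • (x * z) := by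
    rw [mul_add, add_mul, add_mul, hx, hz, hzx, add_smul, one_smul]
    abel
  have h1 : x * (z * (y * x)) = 0 := by
    rw [← mul_assoc, hxz, smul_mul_assoc, mul_assoc, hxyx, mul_zero, smul_zero]
  have h2 : z * (y * (x * z)) = 0 := by
    rw [hxz, mul_smul_comm, mul_smul_comm, ← mul_assoc y, ← mul_assoc z, hzyz, zero_mul, smul_zero]
  have h3 : x * (y * (x * z)) = 0 := by
    rw [← mul_assoc y, ← mul_assoc x, hxyx, zero_mul]
  have h4 : z * (x * z) = 0 := by rw [hxz, mul_smul_comm, ← mul_assoc, hz, zero_mul, smul_zero]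
  refine ⟨?_, ?_, ?_⟩
  · rw [hN, mul_smul_comm, add_mul, ← mul_assoc x x, hx, h4, zero_mul, add_zero, smul_zero]
  · rw [← mul_assoc, hN, smul_mul_assoc, mul_assoc, mul_add, mul_add, mul_add, hzyz, h1]
    simp only [add_zero, mul_zero, smul_zero]
  · rw [hN, mul_smul_comm, mul_smul_comm, add_mul, h3, h2, add_zero, smul_zero]

end SerreVanishing

section Family

variable {n : ℕ} {V : Type*} [AddCommGroup V] [Module K V]

theorem HasLSum.serreSum {ι : Type*} {Y : ι → Module.End K V} {T : Module.End K V}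
    (h : HasLSum Y T) (v : K) (m : ℕ) (x : Module.End K V) :
    HasLSum (fun c => serreSum v m x (Y c)) (CnFock.serreSum v m x T) :=
  HasLSum.sum fun r _ => ((h.mul_left (x ^ (m - r))).mul_right (x ^ r)).smul _

/-- Distinct contents of the same colour are not adjacent. -/
theorem add_two_le_of_col_eq (hn : 2 ≤ n) {c c' : ℤ} (h : c < c') (hc : col n c' = col n c) :
    c + 2 ≤ c' := by
  by_contra h'
  obtain rfl : c' = c + 1 := by omega
  exact col_add_one_ne hn c hc

/-- Let `X c` be a locally finite family of endomorphisms indexed by contents such that `X c` and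
`X d` `q`-commute for non-adjacent `c`, `d`, and such that `X c ^ 2` and `X c * X d * X c` vanish for
adjacent `c`, `d`. Then the sums of the family over the colour classes satisfy the quantum Serre
relations. -/
theorem serre_of_family (hn : 2 ≤ n) {X : ℤ → Module.End K V}
    (hX : ∀ c c', c + 2 ≤ c' →
      X c' * X c = qi n (col n c) ^ (-cartan n (col n c) (col n c')) • (X c * X c'))
    (hsq : ∀ c, X c * X c = 0) (hadj : ∀ c d, d = c + 1 ∨ d = c - 1 → X c * (X d * X c) = 0)
    {S : Fin (n + 1) → Module.End K V}
    (hS : ∀ i, HasLSum (fun c => if col n c = i then X c else 0) (S i))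
    {i j : Fin (n + 1)} (hij : i ≠ j) :
    serreSum (qi n i) (1 - cartan n i j).toNat (S i) (S j) = 0 := by
  refine ((hS j).serreSum _ _ _).unique ?_
  convert HasLSum.zero using 2 with d
  split_ifs with hd
  swap
  · simp [serreSum]
  have h0 := qi_ne_zero n i
  have h1 : ∀ m : ℕ, m ≠ 0 → qi n i ^ m ≠ 1 := fun m hm => qi_pow_ne_one n i hm
  have hdi : col n d ≠ i := fun h => hij (h.symm.trans hd)
  -- `X d` sees only the summands of `S i` at `d - 1` and `d + 1`; it `q`-commutes with the rest
  obtain ⟨L, hL⟩ := (hS i).exists_restrict fun c => c < d - 1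
  obtain ⟨R, hR⟩ := (hS i).exists_restrict fun c => d + 1 < c
  have hsplit : S i = L + ((if col n (d - 1) = i then X (d - 1) else 0) +
      (if col n (d + 1) = i then X (d + 1) else 0)) + R := by
    refine (hS i).unique ?_
    convert (hL.add ((HasLSum.single (d - 1) _).add (HasLSum.single (d + 1) _))).add hR using 2
      with c
    rcases lt_trichotomy c d with h | rfl | h
    · by_cases h' : c = d - 1
      · subst h'
        simp [show d - 1 ≠ d + 1 by omega, show ¬ d + 1 < d - 1 by omega]
      · simp [h', show c ≠ d + 1 by omega, show ¬ d + 1 < c by omega, show c < d - 1 by omega]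
    · simp [hdi, show c ≠ c - 1 by omega]
    · by_cases h' : c = d + 1
      · subst h'
        simp [show d + 1 ≠ d - 1 by omega, show ¬ d + 1 < d - 1 by omega]
      · simp [h', show c ≠ d - 1 by omega, show d + 1 < c by omega, show ¬ c < d - 1 by omega]
  have hsame : ∀ c c', c < c' → col n c = i → col n c' = i →
      X c' * X c = (qi n i)⁻¹ ^ 2 • (X c * X c') := by
    intro c c' h hc hc'
    rw [hX c c' (add_two_le_of_col_eq hn h (hc'.trans hc.symm)), hc, hc']
    simp [cartan, zpow_neg, zpow_ofNat]
  have hL' : ∀ Z : Module.End K V, ∀ t : K,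
      (∀ c, c < d - 1 → col n c = i → Z * X c = t • (X c * Z)) → Z * L = t • (L * Z) := by
    intro Z t h
    refine hL.commute_smul fun c => ?_
    split_ifs with h2 h3
    · exact h c h2 h3
    all_goals simp
  have hR' : ∀ Z : Module.End K V, ∀ t : K,
      (∀ c, d + 1 < c → col n c = i → X c * Z = t • (Z * X c)) → R * Z = t • (Z * R) := by
    intro Z t h
    refine hR.commute_smul' fun c => ?_
    split_ifs with h2 h3
    · exact h c h2 h3
    all_goals simp
  have hRL : R * L = (qi n i)⁻¹ ^ 2 • (L * R) :=
    hR' _ _ fun c hc hci => hL' _ _ fun c' hc' hci' => hsame c' c (by omega) hci' hci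
  have hyL : X d * L = qi n i ^ (-cartan n i j) • (L * X d) :=
    hL' _ _ fun c hc hci => by rw [hX c d (by omega), hci, hd]
  have hRy : R * X d = qi n i ^ (-cartan n i j) • (X d * R) :=
    hR' _ _ fun c hc hci => by
      rw [hX d c (by omega), hci, hd, zpow_neg, ← qi_zpow_cartan hn i j, ← zpow_neg]
  have hNL : ∀ e, d - 1 ≤ e → col n e = i → X e * L = (qi n i)⁻¹ ^ 2 • (L * X e) :=
    fun e he hei => hL' _ _ fun c hc hci => hsame c e (by omega) hci hei
  have hRN : ∀ e, e ≤ d + 1 → col n e = i → R * X e = (qi n i)⁻¹ ^ 2 • (X e * R) :=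
    fun e he hei => hR' _ _ fun c hc hci => hsame e c (by omega) hei hci
  have hp := hadj (d - 1) d (Or.inl (by ring))
  have hr := hadj (d + 1) d (Or.inr (by ring))
  have hcart := bump_col hn i d
  rw [hd] at hcart
  have hone : ∀ e, e = d - 1 ∨ e = d + 1 → col n e = i → cartan n i j = -1 → S i = L + X e + R →
      serreSum (qi n i) (1 - cartan n i j).toNat (S i) (X d) = 0 := by
    intro e he hei hcart' hsplit'
    rw [hcart', neg_neg, zpow_one] at hyL hRy
    rw [hcart', hsplit', show (1 - (-1 : ℤ)).toNat = 2 from rfl, serreSum_two h0 h1]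
    exact quantum_serre_two h0 (hNL e (by omega) hei) hRL (hRN e (by omega) hei) hyL hRy (hsq e)
      (hadj e d (by omega))
  by_cases hm : col n (d - 1) = i <;> by_cases hp' : col n (d + 1) = i
  · simp only [bump, ind, Set.indicator_apply, Set.mem_ofPred_eq, hdi, hm, hp', if_true, if_false,
      Pi.one_apply] at hcart
    rw [← hcart, show (-(2 * 0 - 1 - 1 : ℤ)) = (2 : ℕ) from rfl, zpow_natCast] at hyL hRy
    rw [if_pos hm, if_pos hp'] at hsplit
    rw [← hcart, hsplit, show (1 - (2 * 0 - 1 - 1 : ℤ)).toNat = 3 from rfl, serreSum_three h0 h1]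
    have hzx := hsame (d - 1) (d + 1) (by omega) hm hp'
    obtain ⟨hNNN, hNNyN, hNyNN⟩ := words_eq_zero (pow_ne_zero 2 (inv_ne_zero h0)) hzx (hsq _)
      (hsq _) hp hr
    refine quantum_serre_three h0 ?_ hRL ?_ hyL hRy hNNN hNNyN hNyNN
    · rw [add_mul, mul_add, hNL _ le_rfl hm, hNL _ (by omega) hp', smul_add]
    · rw [add_mul, mul_add, hRN _ (by omega) hm, hRN _ le_rfl hp', smul_add]
  · simp only [bump, ind, Set.indicator_apply, Set.mem_ofPred_eq, hdi, hm, hp', if_true, if_false,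
      Pi.one_apply] at hcart
    rw [if_pos hm, if_neg hp', add_zero] at hsplit
    exact hone _ (Or.inl rfl) hm (by omega) hsplit
  · simp only [bump, ind, Set.indicator_apply, Set.mem_ofPred_eq, hdi, hm, hp', if_true, if_false,
      Pi.one_apply] at hcart
    rw [if_neg hm, if_pos hp', zero_add] at hsplit
    exact hone _ (Or.inr rfl) hp' (by omega) hsplit
  · simp only [bump, ind, Set.indicator_apply, Set.mem_ofPred_eq, hdi, hm, hp', if_false,
      Pi.one_apply] at hcart
    rw [← hcart] at hyL hRy
    rw [if_neg hm, if_neg hp', add_zero, add_zero] at hsplit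
    rw [← hcart, hsplit, show (1 - (2 * 0 - 0 - 0 : ℤ)).toNat = 1 from rfl, serreSum_one h0 h1,
      add_mul, mul_add, hyL, hRy]
    simp

end Family

/-! ### Moving one occupied position -/

section Particles

open scoped Classical in
/-- The operator on the space with basis the sets of integers that empties the position `m`, and
kills the basis vectors for which `m` is already empty. -/
def annihilate (m : ℤ) : Module.End K (Set ℤ →₀ K) :=
  Finsupp.linearCombination K fun S => if m ∈ S then Finsupp.single (S \ {m}) 1 else 0

open scoped Classical in
/-- The operator on the space with basis the sets of integers that fills the position `m`, and kills
the basis vectors for which `m` is already filled. -/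
def create (m : ℤ) : Module.End K (Set ℤ →₀ K) :=
  Finsupp.linearCombination K fun S => if m ∈ S then 0 else Finsupp.single (insert m S) 1

open scoped Classical in
theorem annihilate_single (m : ℤ) (S : Set ℤ) : annihilate m (Finsupp.single S 1) =
    if m ∈ S then Finsupp.single (S \ {m}) 1 else 0 := by
  simp [annihilate]

open scoped Classical in
theorem create_single (m : ℤ) (S : Set ℤ) : create m (Finsupp.single S 1) =
    if m ∈ S then 0 else Finsupp.single (insert m S) 1 := by
  simp [create]

theorem annihilate_sq (m : ℤ) : annihilate m * annihilate m = 0 := by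
  refine Finsupp.lhom_ext' fun S => LinearMap.ext_ring ?_
  by_cases h : m ∈ S <;> simp [annihilate_single, h]

theorem create_sq (m : ℤ) : create m * create m = 0 := by
  refine Finsupp.lhom_ext' fun S => LinearMap.ext_ring ?_
  by_cases h : m ∈ S <;> simp [create_single, h]

theorem annihilate_comm (m m' : ℤ) :
    Commute (annihilate m) (annihilate m') := by
  rcases eq_or_ne m m' with rfl | hm
  · exact Commute.refl _
  refine Finsupp.lhom_ext' fun S => LinearMap.ext_ring ?_
  by_cases h : m ∈ S <;> by_cases h' : m' ∈ S <;>
    simp [annihilate_single, h, h', hm, hm.symm, Set.sdiff_sdiff_comm (s := S) (t := {m})]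

theorem create_comm (m m' : ℤ) : Commute (create m) (create m') := by
  rcases eq_or_ne m m' with rfl | hm
  · exact Commute.refl _
  refine Finsupp.lhom_ext' fun S => LinearMap.ext_ring ?_
  by_cases h : m ∈ S <;> by_cases h' : m' ∈ S <;>
    simp [create_single, h, h', hm, hm.symm, Set.insert_comm m m' S]

theorem create_annihilate_comm {m m' : ℤ} (hm : m ≠ m') :
    Commute (create m) (annihilate m') := by
  refine Finsupp.lhom_ext' fun S => LinearMap.ext_ring ?_
  have : insert m (S \ {m'}) = insert m S \ {m'} := Set.insert_sdiff_singleton_comm hm S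
  by_cases h : m ∈ S <;> by_cases h' : m' ∈ S <;>
    simp [create_single, annihilate_single, h, h', hm, hm.symm, this]

/-- The operator that moves an occupied position from `a` to `b`. -/
def hop (a b : ℤ) : Module.End K (Set ℤ →₀ K) := create b * annihilate a

theorem hop_comm {a b a' b' : ℤ} (h : a ≠ b') (h' : a' ≠ b) :
    hop a b * hop a' b' = hop a' b' * hop a b :=
  have h1 : Commute (create b) (hop a' b') :=
    (create_comm b b').mul_right (create_annihilate_comm h'.symm)
  have h2 : Commute (annihilate a) (hop a' b') :=
    (create_annihilate_comm h.symm).symm.mul_right (annihilate_comm a a')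
  (h1.mul_left h2).eq

/-- A position cannot be emptied twice if it is not filled in between. -/
theorem hop_mul_mul_hop_of_commute_annihilate {a b b' : ℤ} {Z : Module.End K (Set ℤ →₀ K)}
    (h : Commute (annihilate a) Z) (hb : a ≠ b') : hop a b * (Z * hop a b') = 0 := by
  have h1 : annihilate a * (Z * create b') = Z * create b' * annihilate a :=
    (h.mul_right (create_annihilate_comm hb.symm).symm).eq
  rw [hop, hop, mul_assoc, ← mul_assoc Z, ← mul_assoc (annihilate a), h1, mul_assoc _ (annihilate a),
    annihilate_sq, mul_zero, mul_zero]

/-- A position cannot be filled twice if it is not emptied in between. -/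
theorem hop_mul_mul_hop_of_commute_create {a a' b : ℤ} {Z : Module.End K (Set ℤ →₀ K)}
    (h : Commute (create b) Z) (hb : a ≠ b) : hop a b * (Z * hop a' b) = 0 := by
  have h1 : create b * (annihilate a * Z) = annihilate a * Z * create b :=
    ((create_annihilate_comm hb.symm).mul_right h).eq
  rw [hop, hop, mul_assoc, ← mul_assoc (annihilate a), ← mul_assoc (create b), h1,
    mul_assoc _ (create b), ← mul_assoc (create b), create_sq, zero_mul, mul_zero]

theorem hop_mul_hop_of_left_eq {a b b' : ℤ} (h : a ≠ b') : hop a b * hop a b' = 0 := by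
  simpa using hop_mul_mul_hop_of_commute_annihilate (b := b) (Commute.one_right _) h

theorem hop_mul_hop_of_right_eq {a b a' : ℤ} (h : a ≠ b) : hop a b * hop a' b = 0 := by
  simpa using hop_mul_mul_hop_of_commute_create (a' := a') (Commute.one_right _) h

theorem hop_hop_hop_succ {a b b' : ℤ} (h : a ≠ b) (h' : a ≠ b') :
    hop a b * (hop b b' * hop a b) = 0 :=
  hop_mul_mul_hop_of_commute_annihilate
    ((create_annihilate_comm h'.symm).symm.mul_right (annihilate_comm a b)) h

theorem hop_hop_hop_pred {a a' b : ℤ} (h : a ≠ b) (h' : a' ≠ b) :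
    hop a b * (hop a' a * hop a b) = 0 :=
  hop_mul_mul_hop_of_commute_create
    ((create_comm b a).mul_right (create_annihilate_comm h'.symm)) h

end Particles

section Moves

open Diagram

variable {k : ℤ}

open scoped Classical in
/-- The operator that removes the convex corner of content `c`, wherever it is on its
antidiagonal. -/
def removeOp (c : ℤ) : Module.End K (Fock k) :=
  Finsupp.linearCombination K fun Y =>
    if h : ∃ Y', Step c Y Y' then Finsupp.single h.choose 1 else 0

open scoped Classical in
/-- The operator that adds a box at the concave corner of content `c`, wherever it is on its
antidiagonal. -/
def addOp (c : ℤ) : Module.End K (Fock k) :=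
  Finsupp.linearCombination K fun Y =>
    if h : ∃ Y', Step c Y' Y then Finsupp.single h.choose 1 else 0

theorem removeOp_single {c : ℤ} {Y Y' : Diagram k} (h : Step c Y Y') :
    removeOp c (Finsupp.single Y 1) = Finsupp.single Y' 1 := by
  have hex : ∃ Y', Step c Y Y' := ⟨Y', h⟩
  simp [removeOp, hex, hex.choose_spec.unique_right h]

theorem removeOp_single_of_not {c : ℤ} {Y : Diagram k} (h : ¬ ∃ Y', Step c Y Y') :
    removeOp c (Finsupp.single Y 1) = 0 := by
  simp only [removeOp, Finsupp.linearCombination_single, dif_neg h, smul_zero]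

theorem addOp_single {c : ℤ} {Y Y' : Diagram k} (h : Step c Y' Y) :
    addOp c (Finsupp.single Y 1) = Finsupp.single Y' 1 := by
  have hex : ∃ Y', Step c Y' Y := ⟨Y', h⟩
  simp [addOp, hex, hex.choose_spec.unique_left h]

theorem addOp_single_of_not {c : ℤ} {Y : Diagram k} (h : ¬ ∃ Y', Step c Y' Y) :
    addOp c (Finsupp.single Y 1) = 0 := by
  simp only [addOp, Finsupp.linearCombination_single, dif_neg h, smul_zero]

/-- The embedding of the Fock space that sends a diagram to its set of occupied positions. -/
def embed : Fock k →ₗ[K] (Set ℤ →₀ K) := Finsupp.lmapDomain K K occ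

theorem embed_injective : Function.Injective (embed (k := k)) :=
  Finsupp.mapDomain_injective occ_injective

theorem embed_removeOp (c : ℤ) (v : Fock k) :
    embed (removeOp c v) = hop (c - 1) c (embed v) := by
  refine LinearMap.congr_fun (f := embed ∘ₗ removeOp c) (g := hop (c - 1) c ∘ₗ embed) ?_ v
  refine Finsupp.lhom_ext' fun Y => LinearMap.ext_ring ?_
  by_cases h : ∃ Y', Step c Y Y'
  · obtain ⟨Y', h⟩ := h
    have h' := h
    obtain ⟨h1, h2, h3⟩ := h'
    simp [removeOp_single h, embed, hop, create_single, annihilate_single, h1, h2, h3]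
  · have h' := h
    rw [exists_step_iff, not_and, not_not] at h'
    simp only [LinearMap.comp_apply, Finsupp.lsingle_apply, removeOp_single_of_not h, map_zero]
    by_cases h1 : c - 1 ∈ Y.occ
    · simp [embed, hop, create_single, annihilate_single, h1, h' h1, show c ≠ c - 1 by omega]
    · simp [embed, hop, annihilate_single, h1]

theorem embed_addOp (c : ℤ) (v : Fock k) :
    embed (addOp c v) = hop c (c - 1) (embed v) := by
  refine LinearMap.congr_fun (f := embed ∘ₗ addOp c) (g := hop c (c - 1) ∘ₗ embed) ?_ v
  refine Finsupp.lhom_ext' fun Y => LinearMap.ext_ring ?_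
  by_cases h : ∃ Y', Step c Y' Y
  · obtain ⟨Y', h⟩ := h
    obtain ⟨h1, h2⟩ := h.mem_right
    simp [addOp_single h, embed, hop, create_single, annihilate_single, h1, h2, h.occ_left]
  · have h' := h
    rw [exists_step_iff', not_and, not_not] at h'
    simp only [LinearMap.comp_apply, Finsupp.lsingle_apply, addOp_single_of_not h, map_zero]
    by_cases h1 : c ∈ Y.occ
    · simp [embed, hop, create_single, annihilate_single, h1, h' h1]
    · simp [embed, hop, annihilate_single, h1]

theorem embed_mul_apply {A B : Module.End K (Fock k)} {A' B' : Module.End K (Set ℤ →₀ K)}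
    (hA : ∀ v, embed (A v) = A' (embed v)) (hB : ∀ v, embed (B v) = B' (embed v)) (v : Fock k) :
    embed ((A * B) v) = (A' * B') (embed v) := by
  rw [Module.End.mul_apply, Module.End.mul_apply, hA, hB]

theorem eq_of_embed {A B : Module.End K (Fock k)} {A' B' : Module.End K (Set ℤ →₀ K)}
    (hA : ∀ v, embed (A v) = A' (embed v)) (hB : ∀ v, embed (B v) = B' (embed v)) (h : A' = B') :
    A = B :=
  LinearMap.ext fun v => embed_injective (by rw [hA, hB, h])

theorem eq_zero_of_embed {A : Module.End K (Fock k)} {A' : Module.End K (Set ℤ →₀ K)}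
    (hA : ∀ v, embed (A v) = A' (embed v)) (h : A' = 0) : A = 0 :=
  eq_of_embed (B' := 0) hA (fun _ => map_zero embed) h

theorem removeOp_comm {c c' : ℤ} (h : c ≠ c' + 1) (h' : c' ≠ c + 1) :
    Commute (removeOp (k := k) c) (removeOp c') :=
  eq_of_embed (embed_mul_apply (embed_removeOp _) (embed_removeOp _))
    (embed_mul_apply (embed_removeOp _) (embed_removeOp _)) (hop_comm (by omega) (by omega))

theorem addOp_comm {c c' : ℤ} (h : c ≠ c' + 1) (h' : c' ≠ c + 1) :
    Commute (addOp (k := k) c) (addOp c') :=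
  eq_of_embed (embed_mul_apply (embed_addOp _) (embed_addOp _))
    (embed_mul_apply (embed_addOp _) (embed_addOp _)) (hop_comm (by omega) (by omega))

theorem removeOp_addOp_comm {c c' : ℤ} (h : c ≠ c') :
    Commute (removeOp (k := k) c) (addOp c') :=
  eq_of_embed (embed_mul_apply (embed_removeOp _) (embed_addOp _))
    (embed_mul_apply (embed_addOp _) (embed_removeOp _)) (hop_comm (by omega) (by omega))

theorem removeOp_mul_addOp_eq_zero {c c' : ℤ} (h : c' = c + 1 ∨ c' = c - 1) :
    removeOp (k := k) c * addOp c' = 0 := by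
  refine eq_zero_of_embed (embed_mul_apply (embed_removeOp _) (embed_addOp _)) ?_
  rcases h with rfl | rfl
  · rw [add_sub_cancel_right]
    exact hop_mul_hop_of_right_eq (by omega)
  · exact hop_mul_hop_of_left_eq (by omega)

theorem removeOp_sq (c : ℤ) : removeOp (k := k) c * removeOp c = 0 :=
  eq_zero_of_embed (embed_mul_apply (embed_removeOp _) (embed_removeOp _))
    (hop_mul_hop_of_left_eq (by omega))

theorem addOp_sq (c : ℤ) : addOp (k := k) c * addOp c = 0 :=
  eq_zero_of_embed (embed_mul_apply (embed_addOp _) (embed_addOp _))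
    (hop_mul_hop_of_left_eq (by omega))

theorem removeOp_removeOp_removeOp {c d : ℤ} (h : d = c + 1 ∨ d = c - 1) :
    removeOp (k := k) c * (removeOp d * removeOp c) = 0 := by
  refine eq_zero_of_embed (embed_mul_apply (embed_removeOp _)
    (embed_mul_apply (embed_removeOp _) (embed_removeOp _))) ?_
  rcases h with rfl | rfl
  · rw [add_sub_cancel_right]
    exact hop_hop_hop_succ (by omega) (by omega)
  · exact hop_hop_hop_pred (by omega) (by omega)

theorem addOp_addOp_addOp {c d : ℤ} (h : d = c + 1 ∨ d = c - 1) :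
    addOp (k := k) c * (addOp d * addOp c) = 0 := by
  refine eq_zero_of_embed (embed_mul_apply (embed_addOp _)
    (embed_mul_apply (embed_addOp _) (embed_addOp _))) ?_
  rcases h with rfl | rfl
  · rw [add_sub_cancel_right]
    exact hop_hop_hop_pred (by omega) (by omega)
  · exact hop_hop_hop_succ (by omega) (by omega)

theorem diagOp_single (f : Diagram k → K) (Y : Diagram k) (a : K) :
    diagOp f (Finsupp.single Y a) = Finsupp.single Y (a * f Y) := by
  simp [diagOp]

theorem removeOp_addOp_sub (c : ℤ) :
    removeOp (k := k) c * addOp c - addOp c * removeOp c =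
      diagOp fun Y => (Y.height c : K) := by
  refine Finsupp.lhom_ext' fun Y => LinearMap.ext_ring ?_
  simp only [LinearMap.comp_apply, Finsupp.lsingle_apply, LinearMap.sub_apply,
    Module.End.mul_apply, diagOp_single, one_mul]
  by_cases h : ∃ Y', Step c Y' Y
  · have h1 : ¬ ∃ Y', Step c Y Y' := fun h' =>
      (exists_step_iff.1 h').2 (exists_step_iff'.1 h).1
    have h2 := exists_step_iff'.1 h
    obtain ⟨Y', h⟩ := h
    rw [addOp_single h, removeOp_single h, removeOp_single_of_not h1, height, ind_of_mem h2.1,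
      ind_of_notMem h2.2]
    simp
  · by_cases h1 : ∃ Y', Step c Y Y'
    · have h2 := exists_step_iff.1 h1
      obtain ⟨Y', h1⟩ := h1
      rw [addOp_single_of_not h, removeOp_single h1, addOp_single h1, height, ind_of_mem h2.1,
        ind_of_notMem h2.2]
      simp
    · rw [addOp_single_of_not h, removeOp_single_of_not h1]
      rw [exists_step_iff'] at h
      rw [exists_step_iff] at h1
      by_cases h2 : c ∈ Y.occ <;> by_cases h3 : c - 1 ∈ Y.occ <;>
        simp [height, ind, h2, h3] <;> tauto

theorem diagOp_mul (f g : Diagram k → K) :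
    (diagOp f * diagOp g : Module.End K (Fock k)) = diagOp fun Y => f Y * g Y := by
  refine Finsupp.lhom_ext' fun Y => LinearMap.ext_ring ?_
  simp [diagOp_single, mul_comm]

theorem diagOp_one : (diagOp fun _ => 1 : Module.End K (Fock k)) = 1 := by
  refine Finsupp.lhom_ext' fun Y => LinearMap.ext_ring ?_
  simp [diagOp_single]

theorem diagOp_mul_removeOp {c : ℤ} {f : Diagram k → K} {t : K}
    (h : ∀ Y Y', Step c Y Y' → f Y' = t * f Y) :
    diagOp f * removeOp c = t • (removeOp c * diagOp f) := by
  refine Finsupp.lhom_ext' fun Y => LinearMap.ext_ring ?_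
  have hs : Finsupp.single Y (1 * f Y) = f Y • Finsupp.single Y (1 : K) := by simp [mul_comm]
  simp only [LinearMap.comp_apply, Finsupp.lsingle_apply, LinearMap.smul_apply,
    Module.End.mul_apply, diagOp_single, hs, map_smul]
  by_cases h1 : ∃ Y', Step c Y Y'
  · obtain ⟨Y', h1⟩ := h1
    simp [removeOp_single h1, diagOp_single, h Y Y' h1]
  · simp [removeOp_single_of_not h1]

theorem diagOp_mul_addOp {c : ℤ} {f : Diagram k → K} {t : K}
    (h : ∀ Y Y', Step c Y' Y → f Y' = t * f Y) :
    diagOp f * addOp c = t • (addOp c * diagOp f) := by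
  refine Finsupp.lhom_ext' fun Y => LinearMap.ext_ring ?_
  have hs : Finsupp.single Y (1 * f Y) = f Y • Finsupp.single Y (1 : K) := by simp [mul_comm]
  simp only [LinearMap.comp_apply, Finsupp.lsingle_apply, LinearMap.smul_apply,
    Module.End.mul_apply, diagOp_single, hs, map_smul]
  by_cases h1 : ∃ Y', Step c Y' Y
  · obtain ⟨Y', h1⟩ := h1
    simp [addOp_single h1, diagOp_single, h Y Y' h1]
  · simp [addOp_single_of_not h1]

end Moves

/-! ### The terms of `E_i` and `F_i` -/

section Terms

open Diagram

variable {n : ℕ} {k : ℤ}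

/-- The diagonal operator with eigenvalue `q_i ^ (ε * wt S Y)` on `Y`. -/
def wtOp (n : ℕ) (i : Fin (n + 1)) (ε : ℤ) (S : Set ℤ) : Module.End K (Fock k) :=
  diagOp fun Y => qi n i ^ (ε * Y.wt S)

theorem diagOp_comm (f g : Diagram k → K) :
    Commute (diagOp f : Module.End K (Fock k)) (diagOp g) := by
  rw [Commute, SemiconjBy, diagOp_mul, diagOp_mul]
  simp only [mul_comm]

theorem wtOp_mul_removeOp (i : Fin (n + 1)) (ε : ℤ) (S : Set ℤ) (c : ℤ) :
    (wtOp n i ε S * removeOp c : Module.End K (Fock k)) =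
      qi n i ^ (ε * bump S c) • (removeOp c * wtOp n i ε S) :=
  diagOp_mul_removeOp fun Y Y' h => by
    rw [h.wt_eq, mul_add, add_comm, zpow_add₀ (qi_ne_zero n i)]

theorem wtOp_mul_addOp (i : Fin (n + 1)) (ε : ℤ) (S : Set ℤ) (c : ℤ) :
    (wtOp n i ε S * addOp c : Module.End K (Fock k)) =
      qi n i ^ (-(ε * bump S c)) • (addOp c * wtOp n i ε S) :=
  diagOp_mul_addOp fun Y Y' h => by
    rw [h.wt_eq, ← zpow_add₀ (qi_ne_zero n i)]
    congr 1
    ring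

/-- The contents of the sites of the colour of `c` beyond `c`. -/
def above (n : ℕ) (c : ℤ) : Set ℤ := {r | col n r = col n c ∧ c < r}

/-- The contents of the sites of the colour of `c` before `c`. -/
def below (n : ℕ) (c : ℤ) : Set ℤ := {r | col n r = col n c ∧ r < c}

theorem bump_congr {S S' : Set ℤ} {c : ℤ} (h : c ∈ S ↔ c ∈ S') (h1 : c + 1 ∈ S ↔ c + 1 ∈ S')
    (h2 : c - 1 ∈ S ↔ c - 1 ∈ S') : bump S c = bump S' c := by
  classical
  simp only [bump, ind, Set.indicator_apply, h, h1, h2]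

theorem bump_empty (c : ℤ) : bump ∅ c = 0 := by simp [bump, ind]

theorem bump_above_of_lt (hn : 2 ≤ n) {c d : ℤ} (h : c + 2 ≤ d) :
    bump (above n c) d = cartan n (col n c) (col n d) := by
  rw [← bump_col hn]
  refine bump_congr ?_ ?_ ?_ <;> simp only [above, Set.mem_ofPred_eq, and_iff_left_iff_imp] <;>
    intro _ <;> omega

theorem bump_above_of_le (hn : 2 ≤ n) {c d : ℤ} (h : d + 2 ≤ c ∨ d = c) :
    bump (above n c) d = 0 := by
  rw [← bump_empty d]
  have := col_add_one_ne hn c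
  refine bump_congr ?_ ?_ ?_ <;>
    simp only [above, Set.mem_ofPred_eq, Set.mem_empty_iff_false, iff_false, not_and] <;>
    intro h' <;> rcases h with h | rfl <;> omega

theorem bump_below_of_lt (hn : 2 ≤ n) {c d : ℤ} (h : d + 2 ≤ c) :
    bump (below n c) d = cartan n (col n c) (col n d) := by
  rw [← bump_col hn]
  refine bump_congr ?_ ?_ ?_ <;> simp only [below, Set.mem_ofPred_eq, and_iff_left_iff_imp] <;>
    intro _ <;> omega

theorem bump_below_of_le (hn : 2 ≤ n) {c d : ℤ} (h : c + 2 ≤ d ∨ d = c) :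
    bump (below n c) d = 0 := by
  rw [← bump_empty d]
  have := col_sub_one_ne hn c
  refine bump_congr ?_ ?_ ?_ <;>
    simp only [below, Set.mem_ofPred_eq, Set.mem_empty_iff_false, iff_false, not_and] <;>
    intro h' <;> rcases h with h | rfl <;> omega

/-- The term `(∏_{p' > p} T_{p'}^+) E_p` of `E_i`, summed over the sites `p` of content `c`. -/
def termE (n : ℕ) (c : ℤ) : Module.End K (Fock k) :=
  wtOp n (col n c) 1 (above n c) * removeOp c

/-- The term `(∏_{p' < p} T_{p'}^-) F_p` of `F_i`, summed over the sites `p` of content `c`. -/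
def termF (n : ℕ) (c : ℤ) : Module.End K (Fock k) :=
  wtOp n (col n c) (-1) (below n c) * addOp c

/-- If `W`, `W'` commute, `P`, `P'` commute, and `W`, `W'` `q`-commute with `P'`, `P`, then `W * P`
and `W' * P'` `q`-commute. -/
theorem mul_mul_mul_comm_of_smul {A : Type*} [Ring A] [Algebra K A] {W W' P P' : A} {s t : K}
    (hs : s ≠ 0) (ht : t ≠ 0) (hW : Commute W W') (hP : Commute P P')
    (h : W * P' = s • (P' * W)) (h' : W' * P = t • (P * W')) :
    W' * P' * (W * P) = (s⁻¹ * t) • (W * P * (W' * P')) := by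
  have h1 : P' * W = s⁻¹ • (W * P') := by rw [h, smul_smul, inv_mul_cancel₀ hs, one_smul]
  have h2 : P * W' = t⁻¹ • (W' * P) := by rw [h', smul_smul, inv_mul_cancel₀ ht, one_smul]
  calc W' * P' * (W * P) = W' * (P' * W) * P := by simp only [mul_assoc]
    _ = s⁻¹ • (W' * W * (P' * P)) := by
      rw [h1, mul_smul_comm, smul_mul_assoc]
      simp only [mul_assoc]
    _ = s⁻¹ • (W * (W' * P) * P') := by
      rw [← hW.eq, ← hP.eq]
      simp only [mul_assoc]
    _ = (s⁻¹ * t) • (W * P * (W' * P')) := by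
      rw [h', mul_smul_comm, smul_mul_assoc, smul_smul]
      simp only [mul_assoc]

theorem termE_mul_termE (hn : 2 ≤ n) {c c' : ℤ} (h : c + 2 ≤ c') :
    (termE n c' * termE n c : Module.End K (Fock k)) =
      qi n (col n c) ^ (-cartan n (col n c) (col n c')) • (termE n c * termE n c') := by
  refine (mul_mul_mul_comm_of_smul (A := Module.End K (Fock k)) (zpow_ne_zero _ (qi_ne_zero n _))
    (zpow_ne_zero _ (qi_ne_zero n _)) (diagOp_comm _ _)
    (removeOp_comm (c := c) (c' := c') (by omega) (by omega))
    (wtOp_mul_removeOp ..) (wtOp_mul_removeOp ..)).trans ?_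
  rw [bump_above_of_lt hn h, bump_above_of_le hn (Or.inl h), ← zpow_neg, mul_zero, zpow_zero,
    mul_one, one_mul]
  rfl

theorem termF_mul_termF (hn : 2 ≤ n) {c c' : ℤ} (h : c' + 2 ≤ c) :
    (termF n c' * termF n c : Module.End K (Fock k)) =
      qi n (col n c) ^ (-cartan n (col n c) (col n c')) • (termF n c * termF n c') := by
  refine (mul_mul_mul_comm_of_smul (A := Module.End K (Fock k)) (zpow_ne_zero _ (qi_ne_zero n _))
    (zpow_ne_zero _ (qi_ne_zero n _)) (diagOp_comm _ _)
    (addOp_comm (c := c) (c' := c') (by omega) (by omega))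
    (wtOp_mul_addOp ..) (wtOp_mul_addOp ..)).trans ?_
  rw [bump_below_of_lt hn h, bump_below_of_le hn (Or.inl h), ← zpow_neg, mul_zero, neg_zero,
    zpow_zero, mul_one, neg_one_mul, neg_neg]
  rfl

theorem termE_termF_comm (hn : 2 ≤ n) {c d : ℤ} (h : c ≠ d) :
    Commute (termE n c : Module.End K (Fock k)) (termF n d) := by
  have key := mul_mul_mul_comm_of_smul (A := Module.End K (Fock k)) (zpow_ne_zero _ (qi_ne_zero n _))
    (zpow_ne_zero _ (qi_ne_zero n _)) (diagOp_comm _ _) (removeOp_addOp_comm (k := k) h)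
    (wtOp_mul_addOp (col n c) 1 (above n c) d) (wtOp_mul_removeOp (col n d) (-1) (below n d) c)
  refine Eq.symm (key.trans ?_)
  change _ • (termE n c * termF n d) = termE n c * termF n d
  by_cases h1 : d = c + 1 ∨ d = c - 1
  · have h2 : (termE n c * termF n d : Module.End K (Fock k)) = 0 := by
      have h3 := wtOp_mul_removeOp (k := k) (col n d) (-1) (below n d) c
      have h4 : (removeOp c * wtOp n (col n d) (-1) (below n d) : Module.End K (Fock k)) =
          (qi n (col n d) ^ (-1 * bump (below n d) c))⁻¹ •
            (wtOp n (col n d) (-1) (below n d) * removeOp c) := by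
        rw [h3, smul_smul, inv_mul_cancel₀ (zpow_ne_zero _ (qi_ne_zero n _)), one_smul]
      rw [termE, termF, mul_assoc, ← mul_assoc (removeOp c), h4, smul_mul_assoc,
        mul_assoc _ (removeOp c), removeOp_mul_addOp_eq_zero h1, mul_zero, smul_zero, mul_zero]
    rw [h2, smul_zero]
  · rcases lt_or_gt_of_ne h with h2 | h2
    · rw [bump_above_of_lt hn (by omega), bump_below_of_lt hn (by omega), one_mul, neg_one_mul,
        zpow_neg, zpow_neg, inv_inv, ← qi_zpow_cartan hn, mul_inv_cancel₀, one_smul]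
      exact zpow_ne_zero _ (qi_ne_zero n _)
    · rw [bump_above_of_le hn (by omega), bump_below_of_le hn (by omega)]
      simp

theorem mul_mul_eq_zero_of_smul {A : Type*} [Ring A] [Algebra K A] {W P : A} {s : K}
    (h : W * P = s • (P * W)) (hP : P * P = 0) : W * P * (W * P) = 0 := by
  rw [h, smul_mul_assoc, mul_smul_comm, mul_assoc, ← mul_assoc W, h, smul_mul_assoc,
    mul_smul_comm, ← mul_assoc P, ← mul_assoc P, hP, zero_mul, zero_mul, smul_zero, smul_zero,
    smul_zero]

theorem mul_mul_mul_eq_zero_of_smul {A : Type*} [Ring A] [Algebra K A] {W W' P P' : A} {s t u : K}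
    (hs : s ≠ 0) (ht : t ≠ 0) (hu : u ≠ 0) (h : W * P' = s • (P' * W)) (h' : W' * P = t • (P * W'))
    (hu' : W * P = u • (P * W)) (hP : P * (P' * P) = 0) :
    W * P * (W' * P' * (W * P)) = 0 := by
  have h1 : P' * W = s⁻¹ • (W * P') := by rw [h, smul_smul, inv_mul_cancel₀ hs, one_smul]
  have h2 : P * W' = t⁻¹ • (W' * P) := by rw [h', smul_smul, inv_mul_cancel₀ ht, one_smul]
  have h3 : P * W = u⁻¹ • (W * P) := by rw [hu', smul_smul, inv_mul_cancel₀ hu, one_smul]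
  calc W * P * (W' * P' * (W * P)) = W * (P * W') * (P' * W) * P := by simp only [mul_assoc]
    _ = (s⁻¹ * t⁻¹) • (W * W' * (P * W) * (P' * P)) := by
      rw [h1, h2]
      simp only [mul_smul_comm, smul_mul_assoc, smul_smul, mul_assoc]
    _ = 0 := by
      rw [h3]
      simp only [mul_smul_comm, smul_mul_assoc, mul_assoc, hP, mul_zero, smul_zero]

theorem termE_sq (c : ℤ) : (termE n c * termE n c : Module.End K (Fock k)) = 0 :=
  mul_mul_eq_zero_of_smul (A := Module.End K (Fock k)) (wtOp_mul_removeOp ..) (removeOp_sq c)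

theorem termF_sq (c : ℤ) : (termF n c * termF n c : Module.End K (Fock k)) = 0 :=
  mul_mul_eq_zero_of_smul (A := Module.End K (Fock k)) (wtOp_mul_addOp ..) (addOp_sq c)

theorem termE_termE_termE {c d : ℤ} (h : d = c + 1 ∨ d = c - 1) :
    (termE n c * (termE n d * termE n c) : Module.End K (Fock k)) = 0 :=
  mul_mul_mul_eq_zero_of_smul (A := Module.End K (Fock k)) (zpow_ne_zero _ (qi_ne_zero n _))
    (zpow_ne_zero _ (qi_ne_zero n _)) (zpow_ne_zero _ (qi_ne_zero n _)) (wtOp_mul_removeOp ..)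
    (wtOp_mul_removeOp ..) (wtOp_mul_removeOp ..) (removeOp_removeOp_removeOp h)

theorem termF_termF_termF {c d : ℤ} (h : d = c + 1 ∨ d = c - 1) :
    (termF n c * (termF n d * termF n c) : Module.End K (Fock k)) = 0 :=
  mul_mul_mul_eq_zero_of_smul (A := Module.End K (Fock k)) (zpow_ne_zero _ (qi_ne_zero n _))
    (zpow_ne_zero _ (qi_ne_zero n _)) (zpow_ne_zero _ (qi_ne_zero n _)) (wtOp_mul_addOp ..)
    (wtOp_mul_addOp ..) (wtOp_mul_addOp ..) (addOp_addOp_addOp h)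

/-- The twists by `above` and `below` commute with both moves of content `c`, so that only the
commutator of the moves remains. -/
theorem termE_termF_sub (hn : 2 ≤ n) (c : ℤ) :
    (termE n c * termF n c - termF n c * termE n c : Module.End K (Fock k)) =
      diagOp fun Y => qi n (col n c) ^ (Y.wt (above n c) - Y.wt (below n c)) * (Y.height c : K) := by
  have h1 : Commute (wtOp n (col n c) 1 (above n c) : Module.End K (Fock k)) (addOp c) := by
    have := wtOp_mul_addOp (k := k) (col n c) 1 (above n c) c
    rwa [bump_above_of_le hn (Or.inr rfl), mul_zero, neg_zero, zpow_zero, one_smul] at this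
  have h2 : Commute (wtOp n (col n c) (-1) (below n c) : Module.End K (Fock k)) (removeOp c) := by
    have := wtOp_mul_removeOp (k := k) (col n c) (-1) (below n c) c
    rwa [bump_below_of_le hn (Or.inr rfl), mul_zero, zpow_zero, one_smul] at this
  have h3 : Commute (wtOp n (col n c) 1 (above n c) : Module.End K (Fock k))
      (wtOp n (col n c) (-1) (below n c)) := diagOp_comm _ _
  have h4 : (termE n c * termF n c - termF n c * termE n c : Module.End K (Fock k)) =
      wtOp n (col n c) 1 (above n c) * wtOp n (col n c) (-1) (below n c) *
        (removeOp c * addOp c - addOp c * removeOp c) := by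
    refine Eq.trans ?_ (mul_sub (α := Module.End K (Fock k)) _ _ _).symm
    congr 1
    · rw [termE, termF, mul_assoc, ← mul_assoc (removeOp c), ← h2.eq]
      simp only [mul_assoc]
    · rw [termE, termF, mul_assoc, ← mul_assoc (addOp c), ← h1.eq, h3.eq]
      simp only [mul_assoc]
  rw [h4, removeOp_addOp_sub, wtOp, wtOp, diagOp_mul, diagOp_mul]
  congr 1
  funext Y
  rw [← zpow_add₀ (qi_ne_zero n _), one_mul, neg_one_mul, sub_eq_add_neg]

end Terms

open Diagram

variable {n : ℕ} {k : ℤ}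

/-! ### The operators `E_i`, `F_i` and `T_i` as sums over contents -/

/-- A sum over the sites of a diagram with content in `J`, supported on the corners, is a sum over
`J`. -/
theorem finsum_sites {M : Type*} [AddCommMonoid M] (Y : Diagram k) (J : Set ℤ) {f : ℕ × ℤ → M}
    {g : ℤ → M} (hf : ∀ p, ¬ (Y.IsConcave p ∨ Y.IsConvex p) → f p = 0)
    (hg : ∀ c, Y.height c = 0 → g c = 0)
    (h : ∀ p : ℕ × ℤ, (p.1 : ℤ) + p.2 ∈ J → Y.IsConcave p ∨ Y.IsConvex p →
      f p = g ((p.1 : ℤ) + p.2)) :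
    ∑ᶠ p ∈ {p : ℕ × ℤ | (p.1 : ℤ) + p.2 ∈ J}, f p = ∑ᶠ c ∈ J, g c := by
  have h1 : ∑ᶠ p ∈ {p : ℕ × ℤ | (p.1 : ℤ) + p.2 ∈ J}, f p =
      ∑ᶠ p ∈ {p : ℕ × ℤ | (p.1 : ℤ) + p.2 ∈ J} ∩ {p | Y.IsConcave p ∨ Y.IsConvex p}, f p :=
    finsum_mem_inter_support_eq' _ _ _ fun p hp =>
      (and_iff_left (not_not.1 fun h => hp (hf p h))).symm
  have h2 : ∑ᶠ c ∈ J, g c = ∑ᶠ c ∈ J ∩ Function.support Y.height, g c :=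
    finsum_mem_inter_support_eq' _ _ _ fun c hc => (and_iff_left fun h => hc (hg c h)).symm
  rw [h1, h2]
  exact finsum_mem_eq_of_bijOn _ (Y.bijOn_corners J) fun p hp => h p hp.1 hp.2

theorem coloured_eq (hn : 2 ≤ n) (i : Fin (n + 1)) :
    coloured n i = {p : ℕ × ℤ | (p.1 : ℤ) + p.2 ∈ {c | col n c = i}} :=
  Set.ext fun _ => mem_coloured_iff (by omega)

theorem prodT_eq (i : Fin (n + 1)) (ε : ℤ) (S : Set ℤ) (P : Set (ℕ × ℤ))
    (hP : ∀ p : ℕ × ℤ, p ∈ P ↔ (p.1 : ℤ) + p.2 ∈ S) : prodT n i ε (k := k) P = wtOp n i ε S := by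
  rw [prodT, wtOp]
  congr 1
  funext Y
  exact finprod_siteT n i ε Y S P hP (qi_ne_zero n i)

theorem termE_single_of_height {Y : Diagram k} {c : ℤ} (h : Y.height c ≠ -1) :
    termE n c (Finsupp.single Y 1) = 0 := by
  rw [termE, Module.End.mul_apply, removeOp_single_of_not, map_zero]
  intro h'
  obtain ⟨h1, h2⟩ := exists_step_iff.1 h'
  exact h (by rw [height, ind_of_mem h1, ind_of_notMem h2, zero_sub])

theorem termF_single_of_height {Y : Diagram k} {c : ℤ} (h : Y.height c ≠ 1) :
    termF n c (Finsupp.single Y 1) = 0 := by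
  rw [termF, Module.End.mul_apply, addOp_single_of_not, map_zero]
  intro h'
  obtain ⟨h1, h2⟩ := exists_step_iff'.1 h'
  exact h (by rw [height, ind_of_mem h1, ind_of_notMem h2, sub_zero])

theorem finsum_mem_col {M : Type*} [AddCommMonoid M] (i : Fin (n + 1)) (f : ℤ → M) :
    ∑ᶠ c ∈ {c | col n c = i}, f c = ∑ᶠ c, if col n c = i then f c else 0 :=
  finsum_congr fun c => by by_cases h : col n c = i <;> simp [h]

theorem hasLSum_termE (hn : 2 ≤ n) (i : Fin (n + 1)) :
    HasLSum (fun c => if col n c = i then termE n c else 0) (E n i (k := k)) := by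
  refine HasLSum.of_single fun Y => ⟨?_, ?_⟩
  · refine Y.finite_support_height.subset fun c hc h => hc ?_
    dsimp only
    split_ifs
    · exact termE_single_of_height (by rw [h]; norm_num)
    · rfl
  · have h1 : ∀ c, (if col n c = i then termE n c else 0 : Module.End K (Fock k))
        (Finsupp.single Y 1) = if col n c = i then termE n c (Finsupp.single Y 1) else 0 :=
      fun c => by split_ifs <;> rfl
    simp only [h1]
    rw [← finsum_mem_col, E, Finsupp.linearCombination_single, one_smul, coloured_eq hn]
    refine finsum_sites Y _ ?_ (fun c hc => termE_single_of_height (by rw [hc]; norm_num)) ?_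
    · intro p hp
      rw [siteE_single_of_not p Y fun h => hp (Or.inr h), map_zero]
    · rintro p hpi (hp | hp)
      · rw [siteE_single_of_not p Y fun h => h.mem_occ.2 hp.mem_occ.1, map_zero,
          termE_single_of_height]
        rw [height_of_isConcave hp]
        norm_num
      · rw [siteE_single p Y hp, termE, Module.End.mul_apply, removeOp_single (step_removeCorner hp),
          show col n ((p.1 : ℤ) + p.2) = i from hpi, prodT_eq]
        intro p'
        simp only [above, Set.mem_ofPred_eq]
        rw [show col n ((p.1 : ℤ) + p.2) = i from hpi]

theorem hasLSum_termF (hn : 2 ≤ n) (i : Fin (n + 1)) :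
    HasLSum (fun c => if col n c = i then termF n c else 0) (F n i (k := k)) := by
  refine HasLSum.of_single fun Y => ⟨?_, ?_⟩
  · refine Y.finite_support_height.subset fun c hc h => hc ?_
    dsimp only
    split_ifs
    · exact termF_single_of_height (by rw [h]; norm_num)
    · rfl
  · have h1 : ∀ c, (if col n c = i then termF n c else 0 : Module.End K (Fock k))
        (Finsupp.single Y 1) = if col n c = i then termF n c (Finsupp.single Y 1) else 0 :=
      fun c => by split_ifs <;> rfl
    simp only [h1]
    rw [← finsum_mem_col, F, Finsupp.linearCombination_single, one_smul, coloured_eq hn]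
    refine finsum_sites Y _ ?_ (fun c hc => termF_single_of_height (by rw [hc]; norm_num)) ?_
    · intro p hp
      rw [siteF_single_of_not p Y fun h => hp (Or.inl h), map_zero]
    · rintro p hpi (hp | hp)
      · rw [siteF_single p Y hp, termF, Module.End.mul_apply, addOp_single (step_addCorner hp),
          show col n ((p.1 : ℤ) + p.2) = i from hpi, prodT_eq]
        intro p'
        simp only [below, Set.mem_ofPred_eq]
        rw [show col n ((p.1 : ℤ) + p.2) = i from hpi]
      · rw [siteF_single_of_not p Y fun h => hp.mem_occ.2 h.mem_occ.1, map_zero,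
          termF_single_of_height]
        rw [height_of_isConvex hp]
        norm_num

theorem serreSum_E (hn : 2 ≤ n) {i j : Fin (n + 1)} (hij : i ≠ j) :
    serreSum (A := Module.End K (Fock k)) (qi n i) (1 - cartan n i j).toNat (E n i) (E n j) = 0 :=
  serre_of_family hn (fun _ _ h => termE_mul_termE hn h) termE_sq
    (fun _ _ h => termE_termE_termE h) (hasLSum_termE hn) hij

theorem serreSum_F (hn : 2 ≤ n) {i j : Fin (n + 1)} (hij : i ≠ j) :
    serreSum (A := Module.End K (Fock k)) (qi n i) (1 - cartan n i j).toNat (F n i) (F n j) = 0 := by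
  -- the order of the contents is reversed, since `F_i` is twisted by the sites before a box
  have hS : ∀ i, HasLSum (fun c => if col n c = i then termF n (-c) else 0) (F n i (k := k)) := by
    intro i
    have := (hasLSum_termF (k := k) hn i).comp_equiv (Equiv.neg ℤ)
    simpa only [Equiv.neg_apply, col_neg n (show 1 ≤ n by omega)] using this
  have hX : ∀ c c', c + 2 ≤ c' → (termF n (-c') * termF n (-c) : Module.End K (Fock k)) =
      qi n (col n c) ^ (-cartan n (col n c) (col n c')) • (termF n (-c) * termF n (-c')) := by
    intro c c' h
    rw [termF_mul_termF hn (by omega), col_neg n (by omega), col_neg n (by omega)]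
  have hadj : ∀ c d, d = c + 1 ∨ d = c - 1 →
      (termF n (-c) * (termF n (-d) * termF n (-c)) : Module.End K (Fock k)) = 0 :=
    fun c d h => termF_termF_termF (by omega)
  exact serre_of_family hn hX (fun c => termF_sq (-c)) hadj hS hij

/-! ### The commutators of `E_i` and `F_j` -/

/-- Of the terms of `F_j`, only the term of content `c` fails to commute with `termE n c`. -/
theorem termE_sub_F (hn : 2 ≤ n) (c : ℤ) (j : Fin (n + 1)) :
    (termE n c * F n j - F n j * termE n c : Module.End K (Fock k)) =
      if col n c = j then termE n c * termF n c - termF n c * termE n c else 0 := by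
  refine ((hasLSum_termF (k := k) hn j).commutator_eq c fun d hd => ?_).trans ?_
  · split_ifs
    · exact termE_termF_comm hn hd.symm
    · exact Commute.zero_right _
  · split_ifs
    · rfl
    · rw [mul_zero, zero_mul]
      exact sub_self (G := Module.End K (Fock k)) 0

theorem hasLSum_E_F (hn : 2 ≤ n) (i j : Fin (n + 1)) :
    HasLSum (fun c => if col n c = i ∧ col n c = j then
      termE n c * termF n c - termF n c * termE n c else 0)
      (E n i * F n j - F n j * E n i : Module.End K (Fock k)) := by
  convert (hasLSum_termE (k := k) hn i).commutator (F n j) using 2 with c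
  by_cases hi : col n c = i
  · rw [if_pos hi, termE_sub_F hn c j]
    simp only [hi, true_and]
  · rw [if_neg hi, if_neg fun h => hi h.1, mul_zero, zero_mul]
    exact (sub_self (G := Module.End K (Fock k)) 0).symm

theorem E_F_comm (hn : 2 ≤ n) {i j : Fin (n + 1)} (hij : i ≠ j) :
    (E n i * F n j - F n j * E n i : Module.End K (Fock k)) = 0 := by
  refine (hasLSum_E_F hn i j).unique ?_
  convert HasLSum.zero using 2 with c
  rw [if_neg]
  rintro ⟨rfl, h⟩
  exact hij h

theorem Diagram.wt_insert (Y : Diagram k) {S : Set ℤ} {c : ℤ} (hc : c ∉ S) :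
    Y.wt (insert c S) = Y.height c + Y.wt S :=
  finsum_mem_insert' _ hc (Y.finite_support_height.inter_of_right S)

theorem Diagram.wt_congr (Y : Diagram k) {S S' : Set ℤ} (h : ∀ c, Y.height c ≠ 0 → (c ∈ S ↔ c ∈ S')) :
    Y.wt S = Y.wt S' :=
  finsum_mem_inter_support_eq' _ _ _ h

theorem Diagram.height_mem (Y : Diagram k) (c : ℤ) :
    Y.height c = 1 ∨ Y.height c = 0 ∨ Y.height c = -1 := by
  by_cases h1 : c ∈ Y.occ <;> by_cases h2 : c - 1 ∈ Y.occ <;> simp [height, ind, h1, h2]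

/-- The potential whose differences are the eigenvalues of the terms of `[E_i, F_i]`. -/
def potential (n : ℕ) (i : Fin (n + 1)) (Y : Diagram k) (c : ℤ) : K :=
  qi n i ^ (Y.wt {r | col n r = i ∧ c ≤ r} - Y.wt {r | col n r = i ∧ r < c})

theorem potential_sub (i : Fin (n + 1)) (Y : Diagram k) (c : ℤ) :
    (qi n i - (qi n i)⁻¹)⁻¹ * (potential n i Y c - potential n i Y (c + 1)) =
      if col n c = i then qi n i ^ (Y.wt (above n c) - Y.wt (below n c)) * (Y.height c : K)
      else 0 := by
  split_ifs with hi
  · have h1 : {r | col n r = i ∧ c ≤ r} = insert c (above n c) := by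
      ext r
      simp only [above, Set.mem_ofPred_eq, Set.mem_insert_iff, hi, le_iff_eq_or_lt]
      grind
    have h2 : {r | col n r = i ∧ r < c + 1} = insert c (below n c) := by
      ext r
      simp only [below, Set.mem_ofPred_eq, Set.mem_insert_iff, hi, Int.lt_add_one_iff,
        le_iff_eq_or_lt]
      grind
    have h3 : {r | col n r = i ∧ c + 1 ≤ r} = above n c := by
      simp only [above, hi, Int.add_one_le_iff]
    have h4 : {r | col n r = i ∧ r < c} = below n c := by simp only [below, hi]
    rw [potential, potential, h1, h2, h3, h4, Y.wt_insert (by simp [above]),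
      Y.wt_insert (by simp [below])]
    have h0 := qi_ne_zero n i
    have hv := qi_sub_inv_ne_zero n i
    rw [show Y.height c + Y.wt (above n c) - Y.wt (below n c) =
        Y.wt (above n c) - Y.wt (below n c) + Y.height c by ring,
      show Y.wt (above n c) - (Y.height c + Y.wt (below n c)) =
        Y.wt (above n c) - Y.wt (below n c) + -Y.height c by ring, zpow_add₀ h0, zpow_add₀ h0,
      inv_mul_eq_iff_eq_mul₀ hv]
    rcases Y.height_mem c with h | h | h <;> rw [h] <;> simp <;> ring
  · have h1 : {r | col n r = i ∧ c ≤ r} = {r | col n r = i ∧ c + 1 ≤ r} := by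
      ext r
      simp only [Set.mem_ofPred_eq, Int.add_one_le_iff, le_iff_eq_or_lt (a := c)]
      grind
    have h2 : {r | col n r = i ∧ r < c + 1} = {r | col n r = i ∧ r < c} := by
      ext r
      simp only [Set.mem_ofPred_eq, Int.lt_add_one_iff, le_iff_eq_or_lt]
      grind
    rw [potential, potential, h1, h2, sub_self, mul_zero]

theorem finsum_potential_sub (i : Fin (n + 1)) (Y : Diagram k) :
    ∑ᶠ c, (if col n c = i then qi n i ^ (Y.wt (above n c) - Y.wt (below n c)) * (Y.height c : K)
      else 0) =
      (qi n i - (qi n i)⁻¹)⁻¹ * (qi n i ^ (1 * Y.wt {r | col n r = i}) -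
        qi n i ^ (-1 * Y.wt {r | col n r = i})) := by
  obtain ⟨a, ha⟩ := Y.finite_support_height.bddBelow
  obtain ⟨b, hb⟩ := Y.finite_support_height.bddAbove
  obtain ⟨N, hN⟩ : ∃ N : ℕ, b < a + N := ⟨(b + 1 - a).toNat, by omega⟩
  rw [finsum_eq_sum_of_support_subset _ (s := (Finset.range N).image fun m : ℕ => a + (m : ℤ))]
  · rw [Finset.sum_image fun x _ y _ h => by simpa using h]
    simp only [← potential_sub, ← Finset.mul_sum]
    have := Finset.sum_range_sub' (fun m : ℕ => potential n i Y (a + m)) N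
    push_cast at this
    simp only [← add_assoc, add_zero] at this
    rw [this, potential, potential]
    congr 3
    · rw [one_mul, Y.wt_congr (S' := {r | col n r = i}), Y.wt_congr (S := {r | _ ∧ r < a}) (S' := ∅)]
      · simp [wt]
      · intro c hc
        have := ha hc
        simp
        omega
      · intro c hc
        have := ha hc
        simp
        omega
    · rw [Y.wt_congr (S := {r | _ ∧ r < _}) (S' := {r | col n r = i}),
        Y.wt_congr (S := {r | _ ∧ _ ≤ r}) (S' := ∅)]
      · simp [wt]
      · intro c hc
        have := hb hc
        simp
        omega
      · intro c hc
        have := hb hc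
        simp
        omega
  · intro c hc
    have hc' : Y.height c ≠ 0 := fun h => hc (by simp [h])
    have h1 := ha hc'
    have h2 := hb hc'
    simp only [Finset.coe_image, Set.mem_image, Finset.coe_range, Set.mem_Iio]
    exact ⟨(c - a).toNat, by omega, by omega⟩

/-- The commutator `[E_i, F_i]` is diagonal, and its eigenvalue on a diagram is a telescoping sum
over the contents of colour `i`. -/
theorem E_F_sub (hn : 2 ≤ n) (i : Fin (n + 1)) :
    (E n i * F n i - F n i * E n i : Module.End K (Fock k)) =
      (qi n i - (qi n i)⁻¹)⁻¹ • (wtOp n i 1 {r | col n r = i} - wtOp n i (-1) {r | col n r = i}) := by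
  refine (hasLSum_E_F hn i i).unique (HasLSum.of_single fun Y => ?_)
  have h1 : ∀ c, (if col n c = i ∧ col n c = i then
      termE n c * termF n c - termF n c * termE n c else 0 : Module.End K (Fock k))
      (Finsupp.single Y 1) = Finsupp.single Y (if col n c = i then
        qi n i ^ (Y.wt (above n c) - Y.wt (below n c)) * (Y.height c : K) else 0) := by
    intro c
    by_cases hi : col n c = i
    · rw [if_pos ⟨hi, hi⟩, if_pos hi, termE_termF_sub hn, diagOp_single, one_mul, hi]
    · simp [hi]
  simp only [h1]
  have hfin : (Function.support fun c => if col n c = i then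
      qi n i ^ (Y.wt (above n c) - Y.wt (below n c)) * (Y.height c : K) else 0).Finite :=
    Y.finite_support_height.subset fun c hc h => hc (by simp [h])
  refine ⟨hfin.subset fun c hc h => hc (by simp only at h ⊢; rw [h, Finsupp.single_zero]), ?_⟩
  refine Eq.trans ?_ ((Finsupp.singleAddHom Y).map_finsum hfin)
  rw [finsum_potential_sub, LinearMap.smul_apply, LinearMap.sub_apply, wtOp, wtOp, diagOp_single,
    diagOp_single, one_mul, one_mul, one_mul, Finsupp.singleAddHom_apply, ← Finsupp.single_sub,
    Finsupp.smul_single, smul_eq_mul]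

/-! ### The torus and the module structure -/

/-- The pairing of a coweight `∑ c_i h_i + m d` with the weight of a diagram: `h_i` gives the weight on
the contents of colour `i`, and `d` gives minus the number of boxes of colour `0`. -/
def pairing (n : ℕ) (h : Coweight n) (Y : Diagram k) : ℤ :=
  ∑ i, h.1 i * Y.wt {r | col n r = i} - h.2 * ((Y.boxes ∩ coloured n 0).ncard : ℤ)

theorem pairing_add (h h' : Coweight n) (Y : Diagram k) :
    pairing n (h + h') Y = pairing n h Y + pairing n h' Y := by
  simp only [pairing, Prod.fst_add, Prod.snd_add, Pi.add_apply, add_mul, Finset.sum_add_distrib]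
  ring

theorem pairing_zero (Y : Diagram k) : pairing n 0 Y = 0 := by
  simp [pairing]

theorem pairing_neg (h : Coweight n) (Y : Diagram k) : pairing n (-h) Y = -pairing n h Y := by
  have := pairing_add h (-h) Y
  rw [add_neg_cancel, pairing_zero] at this
  omega

theorem pairing_smul_hElt (m : ℕ) (i : Fin (n + 1)) (Y : Diagram k) :
    pairing n (m • hElt n i) Y = m * Y.wt {r | col n r = i} := by
  simp [pairing, hElt, Pi.single_apply]

theorem pairing_step (hn : 2 ≤ n) (h : Coweight n) {c : ℤ} {Y Y' : Diagram k} (hY : Step c Y Y') :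
    pairing n h Y' = simpleRoot n (col n c) h + pairing n h Y := by
  classical
  have h1 := hY.ncard_boxes (coloured n 0) {r | col n r = 0} fun p => mem_coloured_iff (by omega)
  simp only [pairing, simpleRoot, hY.wt_eq, bump_col hn, mul_add, Finset.sum_add_distrib, h1,
    Set.mem_ofPred_eq]
  split_ifs <;> ring

/-- The operator by which `q^h` acts. -/
def torusOp (n : ℕ) (h : Coweight n) : Module.End K (Fock k) := diagOp fun Y => q ^ pairing n h Y

theorem torusOp_zero : torusOp n 0 = (1 : Module.End K (Fock k)) := by
  simp only [torusOp, pairing_zero, zpow_zero, diagOp_one]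

theorem torusOp_mul (h h' : Coweight n) :
    (torusOp n h * torusOp n h' : Module.End K (Fock k)) = torusOp n (h + h') := by
  simp only [torusOp, diagOp_mul, pairing_add, zpow_add₀ q_ne_zero]

theorem torusOp_mul_termE (hn : 2 ≤ n) (h : Coweight n) (c : ℤ) :
    (torusOp n h * termE n c : Module.End K (Fock k)) =
      q ^ simpleRoot n (col n c) h • (termE n c * torusOp n h) := by
  have h1 : (torusOp n h * removeOp c : Module.End K (Fock k)) =
      q ^ simpleRoot n (col n c) h • (removeOp c * torusOp n h) :=
    diagOp_mul_removeOp fun Y Y' hY => by rw [pairing_step hn h hY, zpow_add₀ q_ne_zero]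
  have h2 : Commute (torusOp n h : Module.End K (Fock k)) (wtOp n (col n c) 1 (above n c)) :=
    diagOp_comm _ _
  rw [termE, ← mul_assoc, h2.eq, mul_assoc, h1, mul_smul_comm, mul_assoc]

theorem torusOp_mul_termF (hn : 2 ≤ n) (h : Coweight n) (c : ℤ) :
    (torusOp n h * termF n c : Module.End K (Fock k)) =
      q ^ (-simpleRoot n (col n c) h) • (termF n c * torusOp n h) := by
  have h1 : (torusOp n h * addOp c : Module.End K (Fock k)) =
      q ^ (-simpleRoot n (col n c) h) • (addOp c * torusOp n h) :=
    diagOp_mul_addOp fun Y Y' hY => by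
      rw [pairing_step hn h hY, ← zpow_add₀ q_ne_zero, neg_add_cancel_left]
  have h2 : Commute (torusOp n h : Module.End K (Fock k)) (wtOp n (col n c) (-1) (below n c)) :=
    diagOp_comm _ _
  rw [termF, ← mul_assoc, h2.eq, mul_assoc, h1, mul_smul_comm, mul_assoc]

theorem torusOp_conj {h : Coweight n} {S : Module.End K (Fock k)} {t : K}
    (hS : torusOp n h * S = t • (S * torusOp n h)) :
    torusOp n h * S * torusOp n (-h) = t • S := by
  rw [hS, smul_mul_assoc, mul_assoc, torusOp_mul, add_neg_cancel, torusOp_zero, mul_one]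

theorem torusOp_E (hn : 2 ≤ n) (h : Coweight n) (i : Fin (n + 1)) :
    torusOp n h * E n i * torusOp n (-h) =
      q ^ simpleRoot n i h • (E n i : Module.End K (Fock k)) := by
  refine torusOp_conj ((hasLSum_termE hn i).commute_smul fun c => ?_)
  split_ifs with hc
  · rw [torusOp_mul_termE hn, hc]
  · simp

theorem torusOp_F (hn : 2 ≤ n) (h : Coweight n) (i : Fin (n + 1)) :
    torusOp n h * F n i * torusOp n (-h) =
      q ^ (-simpleRoot n i h) • (F n i : Module.End K (Fock k)) := by
  refine torusOp_conj ((hasLSum_termF hn i).commute_smul fun c => ?_)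
  split_ifs with hc
  · rw [torusOp_mul_termF hn, hc]
  · simp

theorem torusOp_smul_hElt (i : Fin (n + 1)) :
    torusOp n (symm n i • hElt n i) = (wtOp n i 1 {r | col n r = i} : Module.End K (Fock k)) := by
  simp only [torusOp, wtOp, pairing_smul_hElt, qi_zpow, one_mul]

theorem torusOp_neg_smul_hElt (i : Fin (n + 1)) :
    torusOp n (-(symm n i • hElt n i)) =
      (wtOp n i (-1) {r | col n r = i} : Module.End K (Fock k)) := by
  simp only [torusOp, wtOp, pairing_neg, pairing_smul_hElt, qi_zpow, neg_one_mul, mul_neg]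

/-- The operators by which the generators of the quantized enveloping algebra act. -/
def genOp (n : ℕ) (k : ℤ) : Gen n → Module.End K (Fock k)
  | Gen.e i => E n i
  | Gen.f i => F n i
  | Gen.qpow h => torusOp n h

/-- The action of the free algebra on the Fock space. -/
def freeRep (n : ℕ) (k : ℤ) : Free n →ₐ[K] Module.End K (Fock k) := FreeAlgebra.lift K (genOp n k)

theorem freeRep_e (i : Fin (n + 1)) : freeRep n k (fe n i) = E n i := FreeAlgebra.lift_ι_apply ..

theorem freeRep_f (i : Fin (n + 1)) : freeRep n k (ff n i) = F n i := FreeAlgebra.lift_ι_apply ..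

theorem freeRep_q (h : Coweight n) : freeRep n k (fq n h) = torusOp n h :=
  FreeAlgebra.lift_ι_apply ..

theorem freeRep_serre (x : Fin (n + 1) → Free n) (i j : Fin (n + 1)) :
    freeRep n k (serre n x i j) = serreSum (qi n i) (1 - cartan n i j).toNat
      (freeRep n k (x i)) (freeRep n k (x j)) := by
  simp only [serre, serreSum, map_sum, map_smul, map_mul, map_pow]

theorem freeRep_rel (hn : 2 ≤ n) {a b : Free n} (h : Rel n a b) :
    freeRep n k a = freeRep n k b := by
  induction h with
  | q_zero => rw [freeRep_q, torusOp_zero, map_one]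
  | q_add h h' => rw [map_mul, freeRep_q, freeRep_q, freeRep_q, torusOp_mul]
  | q_e h i =>
    rw [map_mul, map_mul, map_smul, freeRep_q, freeRep_q, freeRep_e, torusOp_E hn]
  | q_f h i =>
    rw [map_mul, map_mul, map_smul, freeRep_q, freeRep_q, freeRep_f, torusOp_F hn]
  | e_f_same i =>
    rw [map_sub, map_mul, map_mul, map_smul, map_sub, freeRep_q, freeRep_q, freeRep_e, freeRep_f,
      E_F_sub hn, torusOp_smul_hElt, torusOp_neg_smul_hElt]
  | e_f_ne i j hij =>
    rw [map_sub, map_mul, map_mul, map_zero, freeRep_e, freeRep_f, E_F_comm hn hij]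
  | serre_e i j hij => rw [freeRep_serre, freeRep_e, freeRep_e, serreSum_E hn hij, map_zero]
  | serre_f i j hij => rw [freeRep_serre, freeRep_f, freeRep_f, serreSum_F hn hij, map_zero]

/-- The action of the quantized enveloping algebra on the Fock space. -/
def fockRep (hn : 2 ≤ n) (k : ℤ) : Uq n →ₐ[K] Module.End K (Fock k) :=
  RingQuot.liftAlgHom K ⟨freeRep n k, fun _ _ h => freeRep_rel hn h⟩

theorem fockRep_mk (hn : 2 ≤ n) (a : Free n) :
    fockRep hn k (RingQuot.mkAlgHom K (Rel n) a) = freeRep n k a :=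
  RingQuot.liftAlgHom_mkAlgHom_apply ..

end CnFock
end

theorem theorem2p3 (n : ℕ) (hn : 2 ≤ n) (k : Fin (n + 1)) :
    ∃ _M : Module (CnFock.Uq n) (CnFock.Fock (k : ℤ)),
      IsScalarTower CnFock.K (CnFock.Uq n) (CnFock.Fock (k : ℤ)) ∧
      (∀ (i : Fin (n + 1)) (v : CnFock.Fock (k : ℤ)), CnFock.e n i • v = CnFock.E n i v) ∧
      (∀ (i : Fin (n + 1)) (v : CnFock.Fock (k : ℤ)), CnFock.f n i • v = CnFock.F n i v) ∧
      (∀ (i : Fin (n + 1)) (v : CnFock.Fock (k : ℤ)),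
        CnFock.qpow n (CnFock.hElt n i) • v = CnFock.H n i v) ∧
      (∀ (i : Fin (n + 1)) (v : CnFock.Fock (k : ℤ)),
        CnFock.qpow n (CnFock.symm n i • CnFock.hElt n i) • v = CnFock.T n i 1 v ∧
        CnFock.qpow n (-(CnFock.symm n i • CnFock.hElt n i)) • v = CnFock.T n i (-1) v) ∧
      (∀ v : CnFock.Fock (k : ℤ), CnFock.qpow n (CnFock.dElt n) • v = CnFock.Td n v) := by
  open CnFock in
  have hT : ∀ (i : Fin (n + 1)) (ε : ℤ), T n i ε (k := k) = wtOp n i ε {r | col n r = i} :=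
    fun i ε => prodT_eq i ε _ _ fun p => mem_coloured_iff (by omega)
  refine ⟨Module.compHom _ (fockRep hn (k : ℤ)).toRingHom, ?_, ?_, ?_, ?_, ?_, ?_⟩
  · refine @IsScalarTower.mk _ _ _ _ (_) _ fun a u v => ?_
    change fockRep hn (k : ℤ) (a • u) v = a • fockRep hn (k : ℤ) u v
    rw [map_smul, LinearMap.smul_apply]
  · intro i v
    change fockRep hn (k : ℤ) (e n i) v = _
    rw [e, fockRep_mk, freeRep_e]
  · intro i v
    change fockRep hn (k : ℤ) (f n i) v = _
    rw [f, fockRep_mk, freeRep_f]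
  · intro i v
    change fockRep hn (k : ℤ) (qpow n (hElt n i)) v = _
    rw [qpow, fockRep_mk, freeRep_q, torusOp, H]
    congr 2
    funext Y
    rw [← one_smul ℕ (hElt n i), pairing_smul_hElt, Nat.cast_one, one_mul,
      Y.wt_eq_ncard {r | col n r = i} (coloured n i) fun p => mem_coloured_iff (by omega)]
  · intro i v
    change fockRep hn (k : ℤ) (qpow n _) v = _ ∧ fockRep hn (k : ℤ) (qpow n _) v = _
    rw [qpow, qpow, fockRep_mk, fockRep_mk, freeRep_q, freeRep_q, torusOp_smul_hElt,
      torusOp_neg_smul_hElt, hT, hT]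
    exact ⟨rfl, rfl⟩
  · intro v
    change fockRep hn (k : ℤ) (qpow n (dElt n)) v = _
    rw [qpow, fockRep_mk, freeRep_q, torusOp, Td]
    congr 2
    funext Y
    simp [pairing, dElt]
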